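/- Let $\mathds{k}$ be a commutative unital ring. **Exponential modules.** Let $\mathsf{gr}^{\mathsf{op}}$ be the opposite of the category of finitely generated free groups: its objects are the natural numbers, and a morphism $n\to m$ is a group homomorphism $\mathsf F_m\to\mathsf F_n$ between free groups, written $[w_1|\cdots|w_m]_n$ if it sends $x_j$ to the word $w_j\in\mathsf F_n$. It has finite products, given by the sum of natural numbers, and the zero object $0$. A $\mathsf{gr}^{\mathsf{op}}$-module is a functor $F:\mathsf{gr}^{\mathsf{op}}\to\mathsf{Mod}_{\mathds k}$; an exponential $\mathsf{gr}^{\mathsf{op}}$-module is a (strong) symmetric monoidal functor $(\mathsf{gr}^{\mathsf{op}},+,0)\to(\mathsf{Mod}_{\mathds k},\otimes,\mathds k)$. Exponential modules and monoidal natural transformations form the category $\mathcal F^{\mathsf{exp}}(\mathsf{gr}^{\mathsf{op}};\mathds k)$. **The functor $\alpha$.** For a cocommutative Hopf algebra $H$ over $\mathds k$, let $\alpha(H)(n)=H^{\otimes n}$. Here $H$ is regarded as a group object in the category of cocommutative coalgebras (whose product is $\otimes$), and $[w_1|\cdots|w_m]_n$ acts by the coalgebra homomorphism $H^{\otimes n}\to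 H^{\otimes m}$ whose $j$-th component $H^{\otimes n}\to H$ is the word $w_j$ evaluated at the $n$ projections in the convolution group of coalgebra homomorphisms $H^{\otimes n}\to H$. This gives a functor $\alpha:\mathsf{Hopf}^{\mathsf{cc}}_{\mathds k}\to\mathcal F^{\mathsf{exp}}(\mathsf{gr}^{\mathsf{op}};\mathds k)$, with $\alpha(f)=(f^{\otimes n})_n$ on morphisms. **Primitive Hopf algebras.** For a Hopf algebra $H$ put $\mathrm{Prim}(H)=\{a\in H:\ \varepsilon(a)=0,\ \Delta(a)=a\otimes1+1\otimes a\}$ and $P_1(H)=\mathds k\cdot 1+\mathrm{Prim}(H)$. The Hopf algebra $H$ is primitive (primitively generated) if $H=\bigcup_{n}P_1(H)^n$. Let $\mathsf{Hopf}^{\mathsf{cc,prim}}_{\mathds k}$ be the full subcategory of primitive Hopf algebras in $\mathsf{Hopf}^{\mathsf{cc}}_{\mathds k}$. **Primitive modules.** Let $F$ be a $\mathsf{gr}^{\mathsf{op}}$-module. For an object $X$ with zero morphism $p_X:X\to0\to X$ and diagonal $\Delta_X:X\to X+X$, put $$\mathrm{cr}^1(F)(X)=\mathrm{Im}\,(\mathrm{id}-F(p_X)),$$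 $$P_1(F)(X)=\mathrm{Ker}\Bigl((\mathrm{id}-F(p_X+\mathrm{id}_X))\circ(\mathrm{id}-F(\mathrm{id}_X+p_X))\circ F(\Delta_X)\Bigr),$$ and $\widetilde P_1(F)=P_1(\mathrm{cr}^1(F))\subset F$. The primitive part of $F$ is $$\mathcal P(F)(n)=\bigcap_{i=1}^{n}\widetilde P_1\bigl(F((i-1)+(-)+(n-i))\bigr)(1)\subset F(n),$$ so that $\mathcal P(F)(0)=F(0)$. For $n\in\mathds N$ let $Q_n(F)(m)\subset F(m)$ be the submodule generated by all elements $F([w_1|\cdots|w_m]_l)(v)$ with $l\le n$, $v\in\mathcal P(F)(l)$ and $w_1,\dots,w_m$ (possibly empty) words in $x_1,\dots,x_l$ such that each variable $x_i$ occurs exactly once in $w_1,\dots,w_m$ altogether, and never with a negative exponent. The module $F$ is primitive if it is the colimit of this primitive filtration, i.e. $F(m)=\bigcup_nQ_n(F)(m)$ for every $m$. Let $\mathcal F^{\mathsf{exp}}_{\mathsf{prim}}(\mathsf{gr}^{\mathsf{op}};\mathds k)$ be the full subcategory of primitive modules in $\mathcal F^{\mathsf{exp}}(\mathsf{gr}^{\mathsf{op}};\mathds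 k)$. **Theorem.** If $H$ is a primitive cocommutative Hopf algebra over $\mathds k$, then the exponential $\mathsf{gr}^{\mathsf{op}}$-module $\alpha(H)$ is primitive, and the resulting functor $$\mathsf{Hopf}^{\mathsf{cc,prim}}_{\mathds k}\longrightarrow\mathcal F^{\mathsf{exp}}_{\mathsf{prim}}(\mathsf{gr}^{\mathsf{op}};\mathds k)$$ induced by $\alpha$ is fully faithful. If $\mathds k$ is a field, this functor is an equivalence of categories. -/

import Mathlib

open CategoryTheory MonoidalCategory CartesianMonoidalCategory Limits
open scoped TensorProduct

universe u

/-- The category `gr^op`. Its objects are the natural numbers, the object `n` standing for the free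
group `F_n` on `Fin n`; a morphism from `n` to `m` is a group homomorphism `F_m → F_n`. -/
structure GrOp where
  /-- The rank of the free group. -/
  rank : ℕ

namespace GrOp

/-- The free group `F_n`. -/
abbrev free (X : GrOp) : Type := FreeGroup (Fin X.rank)

instance : Category GrOp where
  Hom X Y := Y.free →* X.free
  id X := MonoidHom.id X.free
  comp f g := MonoidHom.comp f g

/-- The group homomorphism `F_m → F_n` underlying a morphism `n ⟶ m`. -/
def toHom {X Y : GrOp} (f : X ⟶ Y) : Y.free →* X.free := f

@[ext]
theorem hom_ext {X Y : GrOp} {f g : X ⟶ Y}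
    (h : ∀ i, toHom f (FreeGroup.of i) = toHom g (FreeGroup.of i)) : f = g :=
  FreeGroup.ext_hom (M := X.free) f g h

@[simp]
theorem toHom_id (X : GrOp) : toHom (𝟙 X) = MonoidHom.id X.free := rfl

@[simp]
theorem toHom_comp {X Y Z : GrOp} (f : X ⟶ Y) (g : Y ⟶ Z) :
    toHom (f ≫ g) = (toHom f).comp (toHom g) := rfl

/-- The morphism `[w_1 | ⋯ | w_m]_n : n ⟶ m` given by the homomorphism `x_j ↦ w_j`. -/
def tuple {X Y : GrOp} (w : Fin Y.rank → X.free) : X ⟶ Y := FreeGroup.lift w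

@[simp]
theorem toHom_tuple_of {X Y : GrOp} (w : Fin Y.rank → X.free) (j : Fin Y.rank) :
    toHom (tuple w : X ⟶ Y) (FreeGroup.of j) = w j :=
  FreeGroup.lift_apply_of

/-- The zero morphism `n ⟶ 0 ⟶ m`, given by the trivial homomorphism. -/
def zero (X Y : GrOp) : X ⟶ Y := tuple fun _ => 1

/-- The first projection `n + m ⟶ n`. -/
def proj₁ (X Y : GrOp) : (⟨X.rank + Y.rank⟩ : GrOp) ⟶ X :=
  tuple fun i => FreeGroup.of (Fin.castAdd Y.rank i)

/-- The second projection `n + m ⟶ m`. -/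
def proj₂ (X Y : GrOp) : (⟨X.rank + Y.rank⟩ : GrOp) ⟶ Y :=
  tuple fun i => FreeGroup.of (Fin.natAdd X.rank i)

/-- The pairing of two morphisms. -/
def pairing {T X Y : GrOp} (f : T ⟶ X) (g : T ⟶ Y) : T ⟶ (⟨X.rank + Y.rank⟩ : GrOp) :=
  tuple (Fin.addCases (fun i => toHom f (FreeGroup.of i)) fun i => toHom g (FreeGroup.of i))

/-- `0` is a terminal object of `gr^op`. -/
def zeroIsTerminal : IsTerminal (⟨0⟩ : GrOp) :=
  IsTerminal.ofUniqueHom (fun X => zero X ⟨0⟩) fun _ _ => hom_ext fun i => i.elim0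

theorem pairing_proj₁ {T X Y : GrOp} (f : T ⟶ X) (g : T ⟶ Y) :
    pairing f g ≫ proj₁ X Y = f := by
  ext i
  have h := toHom_tuple_of (X := T) (Y := ⟨X.rank + Y.rank⟩) (Fin.addCases
    (fun i => toHom f (FreeGroup.of i)) fun i => toHom g (FreeGroup.of i)) (Fin.castAdd Y.rank i)
  simpa [pairing, proj₁] using h

theorem pairing_proj₂ {T X Y : GrOp} (f : T ⟶ X) (g : T ⟶ Y) :
    pairing f g ≫ proj₂ X Y = g := by
  ext i
  have h := toHom_tuple_of (X := T) (Y := ⟨X.rank + Y.rank⟩) (Fin.addCases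
    (fun i => toHom f (FreeGroup.of i)) fun i => toHom g (FreeGroup.of i)) (Fin.natAdd X.rank i)
  simpa [pairing, proj₂] using h

theorem pairing_ext {T X Y : GrOp} {f g : T ⟶ (⟨X.rank + Y.rank⟩ : GrOp)}
    (h₁ : f ≫ proj₁ X Y = g ≫ proj₁ X Y) (h₂ : f ≫ proj₂ X Y = g ≫ proj₂ X Y) : f = g := by
  ext i
  induction i using Fin.addCases with
  | left i => simpa [proj₁] using DFunLike.congr_fun (congrArg toHom h₁) (FreeGroup.of i)
  | right i => simpa [proj₂] using DFunLike.congr_fun (congrArg toHom h₂) (FreeGroup.of i)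

/-- `n + m` is a product of `n` and `m` in `gr^op`. -/
def sumIsProduct (X Y : GrOp) : IsLimit (BinaryFan.mk (proj₁ X Y) (proj₂ X Y)) :=
  BinaryFan.IsLimit.mk _ pairing pairing_proj₁ pairing_proj₂ fun f g _ hf hg =>
    pairing_ext (hf.trans (pairing_proj₁ f g).symm) (hg.trans (pairing_proj₂ f g).symm)

/-- `gr^op` as a monoidal category: the product is the sum of natural numbers (the free product
of groups) and the unit is `0`. -/
instance : CartesianMonoidalCategory GrOp :=
  .ofChosenFiniteProducts ⟨_, zeroIsTerminal⟩ fun X Y => ⟨_, sumIsProduct X Y⟩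

instance : BraidedCategory GrOp := .ofCartesianMonoidalCategory

end GrOp

namespace GrpPower

open scoped MonObj

universe v w

variable {C : Type w} [Category.{v} C] [CartesianMonoidalCategory C]

/-- The `n`-th power of an object: `G^0 = 𝟙` and `G^(n+1) = G^n ⊗ G`. -/
def pow (G : C) : ℕ → C
  | 0 => 𝟙_ C
  | n + 1 => pow G n ⊗ G

/-- The projection `G^(n+1) ⟶ G^n` to the first `n` factors. -/
def front (G : C) (n : ℕ) : pow G (n + 1) ⟶ pow G n := fst (pow G n) G

/-- The projection `G^(n+1) ⟶ G` to the last factor. -/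
def last (G : C) (n : ℕ) : pow G (n + 1) ⟶ G := snd (pow G n) G

/-- The morphism to `G^(n+1)` with given components in `G^n` and `G`. -/
def snoc {X G : C} {n : ℕ} (f : X ⟶ pow G n) (g : X ⟶ G) : X ⟶ pow G (n + 1) := lift f g

@[simp]
theorem snoc_front {X G : C} {n : ℕ} (f : X ⟶ pow G n) (g : X ⟶ G) :
    snoc f g ≫ front G n = f := lift_fst f g

@[simp]
theorem snoc_last {X G : C} {n : ℕ} (f : X ⟶ pow G n) (g : X ⟶ G) :
    snoc f g ≫ last G n = g := lift_snd f g

theorem succ_ext {X G : C} {n : ℕ} {f g : X ⟶ pow G (n + 1)} (h₁ : f ≫ front G n = g ≫ front G n)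
    (h₂ : f ≫ last G n = g ≫ last G n) : f = g :=
  CartesianMonoidalCategory.hom_ext _ _ h₁ h₂

/-- The projections `G^n ⟶ G`. -/
def proj (G : C) : (n : ℕ) → Fin n → (pow G n ⟶ G)
  | 0 => fun i => i.elim0
  | n + 1 => Fin.lastCases (last G n) fun i => front G n ≫ proj G n i

@[simp]
theorem proj_last (G : C) (n : ℕ) : proj G (n + 1) (Fin.last n) = last G n := by
  simp [proj]

@[simp]
theorem proj_castSucc (G : C) (n : ℕ) (i : Fin n) :
    proj G (n + 1) i.castSucc = front G n ≫ proj G n i := by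
  simp [proj]

/-- The morphism to `G^n` with given components. -/
def tupleLift {X G : C} : (n : ℕ) → (Fin n → (X ⟶ G)) → (X ⟶ pow G n)
  | 0, _ => toUnit X
  | n + 1, a => snoc (tupleLift n fun i => a i.castSucc) (a (Fin.last n))

@[simp]
theorem tupleLift_proj {X G : C} (n : ℕ) (a : Fin n → (X ⟶ G)) (i : Fin n) :
    tupleLift n a ≫ proj G n i = a i := by
  induction n with
  | zero => exact i.elim0
  | succ n ih =>
    rw [tupleLift]
    induction i using Fin.lastCases with
    | last => simp
    | cast i => rw [proj_castSucc, ← Category.assoc, snoc_front, ih]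

theorem pow_ext {X G : C} (n : ℕ) {f g : X ⟶ pow G n}
    (h : ∀ i, f ≫ proj G n i = g ≫ proj G n i) : f = g := by
  induction n with
  | zero => exact toUnit_unique _ _
  | succ n ih =>
    refine succ_ext (ih fun i => ?_) ?_
    · simpa using h i.castSucc
    · simpa using h (Fin.last n)

/-- For a group object `G` and a morphism `f : n ⟶ m` of `gr^op`, the morphism `G^n ⟶ G^m` whose
`j`-th component is obtained by evaluating the word `f(x_j) ∈ F_n` at the `n` projections, in the
group of morphisms `G^n ⟶ G`. -/
def powMap (G : C) [GrpObj G] {X Y : GrOp} (f : X ⟶ Y) : pow G X.rank ⟶ pow G Y.rank :=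
  tupleLift Y.rank fun j =>
    FreeGroup.lift (proj G X.rank) (GrOp.toHom f (FreeGroup.of j))

theorem comp_freeGroup_lift {X Y G : C} [GrpObj G] {J : Type} (h : X ⟶ Y) (a : J → (Y ⟶ G))
    (x : FreeGroup J) :
    h ≫ FreeGroup.lift a x = FreeGroup.lift (fun i => h ≫ a i) x := by
  induction x using FreeGroup.induction_on with
  | C1 => simp [MonObj.comp_one]
  | of i => simp
  | inv_of i _ => simp [GrpObj.comp_inv]
  | mul x y hx hy => simp [MonObj.comp_mul, hx, hy]

theorem freeGroup_lift_comp {X G G' : C} [GrpObj G] [GrpObj G'] {J : Type} (a : J → (X ⟶ G))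
    (h : G ⟶ G') [IsMonHom h] (x : FreeGroup J) :
    FreeGroup.lift a x ≫ h = FreeGroup.lift (fun i => a i ≫ h) x := by
  induction x using FreeGroup.induction_on with
  | C1 => simp [MonObj.one_comp]
  | of i => simp
  | inv_of i _ => simp [GrpObj.inv_comp]
  | mul x y hx hy => simp [MonObj.mul_comp, hx, hy]

@[simp]
theorem powMap_proj (G : C) [GrpObj G] {X Y : GrOp} (f : X ⟶ Y) (j : Fin Y.rank) :
    powMap G f ≫ proj G Y.rank j =
      FreeGroup.lift (proj G X.rank) (GrOp.toHom f (FreeGroup.of j)) :=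
  tupleLift_proj _ _ _

theorem powMap_lift_proj (G : C) [GrpObj G] {X Y : GrOp} (f : X ⟶ Y) (x : Y.free) :
    powMap G f ≫ FreeGroup.lift (proj G Y.rank) x =
      FreeGroup.lift (proj G X.rank) (GrOp.toHom f x) := by
  induction x using FreeGroup.induction_on with
  | C1 => simp [MonObj.comp_one]
  | of i => simp
  | inv_of i _ => simp [GrpObj.comp_inv]
  | mul x y hx hy => simp [MonObj.comp_mul, hx, hy]

/-- The functor `n ↦ G^n` on `gr^op` associated with a group object `G`. -/
@[simps]
def powFunctor (G : C) [GrpObj G] : GrOp ⥤ C where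
  obj X := pow G X.rank
  map f := powMap G f
  map_id X := pow_ext _ fun i => by simp
  map_comp f g := pow_ext _ fun i => by simp [powMap_lift_proj]

theorem powMap_naturality {G G' : C} [GrpObj G] [GrpObj G'] (h : G ⟶ G') [IsMonHom h]
    {X Y : GrOp} (f : X ⟶ Y) :
    powMap G f ≫ (tupleLift Y.rank fun i => proj G Y.rank i ≫ h) =
      (tupleLift X.rank fun i => proj G X.rank i ≫ h) ≫ powMap G' f :=
  pow_ext _ fun i => by
    rw [Category.assoc, Category.assoc, tupleLift_proj, powMap_proj, comp_freeGroup_lift,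
      ← Category.assoc, powMap_proj, freeGroup_lift_comp]
    simp only [tupleLift_proj]

/-- The natural transformation induced by a homomorphism of group objects. -/
@[simps]
def powTrans {G G' : C} [GrpObj G] [GrpObj G'] (h : G ⟶ G') [IsMonHom h] :
    powFunctor G ⟶ powFunctor G' where
  app X := tupleLift X.rank fun i => proj G X.rank i ≫ h
  naturality _ _ f := powMap_naturality h f

theorem isIso_prodComparison (G : C) [GrpObj G] (X Y : GrOp) :
    IsIso (CartesianMonoidalCategory.prodComparison (powFunctor G) X Y) := by
  let r : pow G X.rank ⊗ pow G Y.rank ⟶ pow G (X.rank + Y.rank) :=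
    tupleLift (X.rank + Y.rank)
      (Fin.addCases (fun i => fst _ _ ≫ proj G X.rank i) fun i => snd _ _ ≫ proj G Y.rank i)
  have h₁ (i : Fin X.rank) : r ≫ proj G (X.rank + Y.rank) (Fin.castAdd Y.rank i) =
      fst _ _ ≫ proj G X.rank i := by
    rw [tupleLift_proj, Fin.addCases_left]
  have h₂ (i : Fin Y.rank) : r ≫ proj G (X.rank + Y.rank) (Fin.natAdd X.rank i) =
      snd _ _ ≫ proj G Y.rank i := by
    rw [tupleLift_proj, Fin.addCases_right]
  have f₁ (i : Fin X.rank) : powMap G (fst X Y) ≫ proj G X.rank i =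
      proj G (X.rank + Y.rank) (Fin.castAdd Y.rank i) := by
    rw [powMap_proj]
    change FreeGroup.lift _ (GrOp.toHom (GrOp.proj₁ X Y) (FreeGroup.of i)) = _
    rw [GrOp.proj₁, GrOp.toHom_tuple_of]
    exact FreeGroup.lift_apply_of
  have f₂ (i : Fin Y.rank) : powMap G (snd X Y) ≫ proj G Y.rank i =
      proj G (X.rank + Y.rank) (Fin.natAdd X.rank i) := by
    rw [powMap_proj]
    change FreeGroup.lift _ (GrOp.toHom (GrOp.proj₂ X Y) (FreeGroup.of i)) = _
    rw [GrOp.proj₂, GrOp.toHom_tuple_of]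
    exact FreeGroup.lift_apply_of
  let c : pow G (X.rank + Y.rank) ⟶ pow G X.rank ⊗ pow G Y.rank :=
    lift (powMap G (fst X Y)) (powMap G (snd X Y))
  have c₁ : c ≫ fst _ _ = powMap G (fst X Y) := lift_fst _ _
  have c₂ : c ≫ snd _ _ = powMap G (snd X Y) := lift_snd _ _
  have hcr : c ≫ r = 𝟙 (pow G (X.rank + Y.rank)) := by
    refine pow_ext (X.rank + Y.rank) fun i => ?_
    induction i using Fin.addCases with
    | left i =>
      exact (Category.assoc _ _ _).trans <| (c ≫= h₁ i).trans <|
        (Category.assoc _ _ _).symm.trans <| (c₁ =≫ _).trans <| (f₁ i).trans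
        (Category.id_comp _).symm
    | right i =>
      exact (Category.assoc _ _ _).trans <| (c ≫= h₂ i).trans <|
        (Category.assoc _ _ _).symm.trans <| (c₂ =≫ _).trans <| (f₂ i).trans
        (Category.id_comp _).symm
  have hrc : r ≫ c = 𝟙 (pow G X.rank ⊗ pow G Y.rank) := by
    refine CartesianMonoidalCategory.hom_ext _ _ (pow_ext X.rank fun i => ?_)
      (pow_ext Y.rank fun i => ?_)
    · refine Eq.trans ((((Category.assoc _ _ _).trans (r ≫= c₁)) =≫ _).trans ?_)
        ((Category.id_comp _).symm =≫ _)
      exact (Category.assoc _ _ _).trans <| (r ≫= f₁ i).trans (h₁ i)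
    · refine Eq.trans ((((Category.assoc _ _ _).trans (r ≫= c₂)) =≫ _).trans ?_)
        ((Category.id_comp _).symm =≫ _)
      exact (Category.assoc _ _ _).trans <| (r ≫= f₂ i).trans (h₂ i)
  exact ⟨r, hcr, hrc⟩

instance (G : C) [GrpObj G] : PreservesFiniteProducts (powFunctor G) :=
  have := isIso_prodComparison G
  have : IsIso (CartesianMonoidalCategory.terminalComparison (powFunctor G)) :=
    ⟨𝟙 (𝟙_ C), toUnit_unique _ _, toUnit_unique _ _⟩
  have := preservesLimitsOfShape_discrete_walkingPair_of_isIso_prodComparison (powFunctor G)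
  have := preservesLimit_empty_of_isIso_terminalComparison (powFunctor G)
  have := Limits.preservesLimitsOfShape_pempty_of_preservesTerminal (powFunctor G)
  .of_preserves_binary_and_terminal _

/-- The functor `n ↦ G^n` preserves finite products, hence is symmetric monoidal. -/
noncomputable instance (G : C) [GrpObj G] [BraidedCategory C] : (powFunctor G).Braided :=
  .ofChosenFiniteProducts _

end GrpPower

/-- The category of cocommutative `k`-coalgebras and coalgebra homomorphisms. -/
structure CocommCoalg (k : Type u) [CommRing k] where
  /-- The underlying type. -/
  carrier : Type u
  [addCommGroup : AddCommGroup carrier]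
  [module : Module k carrier]
  [coalgebra : Coalgebra k carrier]
  [isCocomm : Coalgebra.IsCocomm k carrier]

namespace CocommCoalg

attribute [instance] addCommGroup module coalgebra isCocomm

variable {k : Type u} [CommRing k]

/-- Morphisms of cocommutative coalgebras. -/
@[ext]
structure Hom (C D : CocommCoalg k) where
  /-- The underlying coalgebra homomorphism. -/
  toCoalgHom : C.carrier →ₗc[k] D.carrier

instance : Category (CocommCoalg k) where
  Hom C D := Hom C D
  id C := ⟨CoalgHom.id k C.carrier⟩
  comp f g := ⟨g.toCoalgHom.comp f.toCoalgHom⟩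

theorem hom_ext {C D : CocommCoalg k} {f g : C ⟶ D}
    (h : ∀ x, f.toCoalgHom x = g.toCoalgHom x) : f = g :=
  Hom.ext (CoalgHom.ext h)

@[simp]
theorem id_apply (C : CocommCoalg k) (x : C.carrier) : (𝟙 C : C ⟶ C).toCoalgHom x = x := rfl

@[simp]
theorem comp_apply {C D E : CocommCoalg k} (f : C ⟶ D) (g : D ⟶ E) (x : C.carrier) :
    (f ≫ g).toCoalgHom x = g.toCoalgHom (f.toCoalgHom x) := rfl

/-- Isomorphisms of cocommutative coalgebras from coalgebra equivalences. -/
@[simps]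
def isoMk {C D : CocommCoalg k} (e : C.carrier ≃ₗc[k] D.carrier) : C ≅ D where
  hom := ⟨e.toCoalgHom⟩
  inv := ⟨e.symm.toCoalgHom⟩
  hom_inv_id := hom_ext fun x => e.symm_apply_apply x
  inv_hom_id := hom_ext fun x => e.apply_symm_apply x

variable (k) in
/-- The forgetful functor from cocommutative coalgebras to modules. -/
def toMod : CocommCoalg k ⥤ ModuleCat.{u} k where
  obj C := ModuleCat.of k C.carrier
  map f := ModuleCat.ofHom f.toCoalgHom.toLinearMap

instance : (toMod k).Faithful where
  map_injective {_ _ _ _} h := hom_ext fun x => congrArg (fun f => f.hom x) h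

noncomputable instance : MonoidalCategoryStruct (CocommCoalg k) where
  tensorObj C D := ⟨C.carrier ⊗[k] D.carrier⟩
  whiskerLeft C _ _ f := ⟨f.toCoalgHom.lTensor C.carrier⟩
  whiskerRight f C := ⟨f.toCoalgHom.rTensor C.carrier⟩
  tensorHom f g := ⟨Coalgebra.TensorProduct.map f.toCoalgHom g.toCoalgHom⟩
  tensorUnit := ⟨k⟩
  associator C D E := isoMk (Coalgebra.TensorProduct.assoc k k C.carrier D.carrier E.carrier)
  leftUnitor C := isoMk (Coalgebra.TensorProduct.lid k C.carrier)
  rightUnitor C := isoMk (Coalgebra.TensorProduct.rid k k C.carrier)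

variable (k) in
/-- The comparison data between tensor products of coalgebras and of modules. -/
noncomputable def inducingData : Monoidal.InducingFunctorData (toMod k) where
  μIso _ _ := Iso.refl _
  whiskerLeft_eq X Y Z f := by ext; rfl
  whiskerRight_eq X f := by ext; rfl
  tensorHom_eq f g := by ext; rfl
  εIso := Iso.refl _
  associator_eq X Y Z := ModuleCat.hom_ext <| TensorProduct.ext <| TensorProduct.ext <| by ext; rfl
  leftUnitor_eq X := ModuleCat.hom_ext <| TensorProduct.ext <| by ext; rfl
  rightUnitor_eq X := ModuleCat.hom_ext <| TensorProduct.ext <| by ext; rfl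

/-- The tensor product of cocommutative coalgebras. -/
noncomputable instance : MonoidalCategory (CocommCoalg k) :=
  Monoidal.induced (toMod k) (inducingData k)

noncomputable instance : (toMod k).Monoidal :=
  Monoidal.fromInducedMonoidal (toMod k) (inducingData k)

/-- The pairing `(f ⊗ g) ∘ Δ` of two coalgebra homomorphisms. -/
noncomputable def pairing {T C D : CocommCoalg k} (f : T ⟶ C) (g : T ⟶ D) : T ⟶ C ⊗ D :=
  ⟨(Coalgebra.TensorProduct.map f.toCoalgHom g.toCoalgHom).comp
    (Coalgebra.comulCoalgHom k T.carrier)⟩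

/-- The counit, as a morphism to the trivial coalgebra `k`. -/
noncomputable def counit (C : CocommCoalg k) : C ⟶ 𝟙_ (CocommCoalg k) :=
  ⟨Coalgebra.counitCoalgHom k C.carrier⟩

theorem eq_counit {C : CocommCoalg k} (f : C ⟶ 𝟙_ (CocommCoalg k)) : f = counit C :=
  hom_ext fun x => CoalgHomClass.counit_comp_apply f.toCoalgHom x

/-- The first projection `id ⊗ ε`. -/
noncomputable def proj₁ (C D : CocommCoalg k) : C ⊗ D ⟶ C := C ◁ counit D ≫ (ρ_ C).hom

/-- The second projection `ε ⊗ id`. -/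
noncomputable def proj₂ (C D : CocommCoalg k) : C ⊗ D ⟶ D := counit C ▷ D ≫ (λ_ D).hom

theorem sum_smul_counit {A J : Type*} [AddCommGroup A] [Module k A] [Coalgebra k A] {a : A}
    (r : Coalgebra.Repr k a J) :
    ∑ i ∈ r.index, Coalgebra.counit (R := k) (r.right i) • r.left i = a := by
  have h := congrArg (TensorProduct.rid k A) (Coalgebra.lTensor_counit_comul (R := k) a)
  rw [← r.eq] at h
  simpa only [map_sum, LinearMap.lTensor_tmul, TensorProduct.rid_tmul, one_smul] using h

theorem pairing_proj₁ {T C D : CocommCoalg k} (f : T ⟶ C) (g : T ⟶ D) :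
    pairing f g ≫ proj₁ C D = f := by
  refine hom_ext fun x => ?_
  change TensorProduct.rid k C.carrier (TensorProduct.map LinearMap.id Coalgebra.counit
    (TensorProduct.map f.toCoalgHom.toLinearMap g.toCoalgHom.toLinearMap
      (Coalgebra.comul x))) = f.toCoalgHom x
  simp [← (Coalgebra.Repr.arbitrary k x).eq]

theorem pairing_proj₂ {T C D : CocommCoalg k} (f : T ⟶ C) (g : T ⟶ D) :
    pairing f g ≫ proj₂ C D = g := by
  refine hom_ext fun x => ?_
  change TensorProduct.lid k D.carrier (TensorProduct.map Coalgebra.counit LinearMap.id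
    (TensorProduct.map f.toCoalgHom.toLinearMap g.toCoalgHom.toLinearMap
      (Coalgebra.comul x))) = g.toCoalgHom x
  simp [← (Coalgebra.Repr.arbitrary k x).eq]

theorem pairing_projs {T C D : CocommCoalg k} (m : T ⟶ C ⊗ D) :
    pairing (m ≫ proj₁ C D) (m ≫ proj₂ C D) = m := by
  have comp_pairing : pairing (m ≫ proj₁ C D) (m ≫ proj₂ C D) =
      m ≫ pairing (proj₁ C D) (proj₂ C D) := by
    refine hom_ext fun x => ?_
    change TensorProduct.map ((proj₁ C D).toCoalgHom.toLinearMap ∘ₗ m.toCoalgHom.toLinearMap)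
      ((proj₂ C D).toCoalgHom.toLinearMap ∘ₗ m.toCoalgHom.toLinearMap) (Coalgebra.comul x) =
      TensorProduct.map (proj₁ C D).toCoalgHom.toLinearMap (proj₂ C D).toCoalgHom.toLinearMap
        (Coalgebra.comul (m.toCoalgHom x))
    rw [← CoalgHomClass.map_comp_comul_apply m.toCoalgHom x, TensorProduct.map_comp]
    rfl
  have key : pairing (proj₁ C D) (proj₂ C D) = 𝟙 (C ⊗ D) := by
    refine hom_ext fun x => ?_
    change (pairing (proj₁ C D) (proj₂ C D)).toCoalgHom.toLinearMap x = LinearMap.id x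
    refine DFunLike.congr_fun (TensorProduct.ext' fun c d => ?_) x
    change TensorProduct.map
      ((TensorProduct.rid k C.carrier).toLinearMap ∘ₗ
        TensorProduct.map LinearMap.id Coalgebra.counit)
      ((TensorProduct.lid k D.carrier).toLinearMap ∘ₗ
        TensorProduct.map Coalgebra.counit LinearMap.id)
      (Coalgebra.comul (c ⊗ₜ[k] d)) = c ⊗ₜ[k] d
    have hc := sum_smul_counit (Coalgebra.Repr.arbitrary k c)
    have hd := Coalgebra.sum_counit_smul (Coalgebra.Repr.arbitrary k d)
    rw [TensorProduct.comul_tmul]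
    conv_rhs => rw [← hc, ← hd]
    simp [← (Coalgebra.Repr.arbitrary k c).eq,
      ← (Coalgebra.Repr.arbitrary k d).eq,
      TensorProduct.sum_tmul, TensorProduct.tmul_sum, TensorProduct.smul_tmul', Finset.smul_sum]
    exact Finset.sum_congr rfl fun _ _ => Finset.sum_congr rfl fun _ _ => by rw [smul_comm]
  rw [comp_pairing, key, Category.comp_id]

/-- The tensor product of cocommutative coalgebras is their product. -/
noncomputable instance : CartesianMonoidalCategory (CocommCoalg k) where
  isTerminalTensorUnit := IsTerminal.ofUniqueHom counit fun _ f => eq_counit f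
  fst := proj₁
  snd := proj₂
  tensorProductIsBinaryProduct C D :=
    BinaryFan.IsLimit.mk _ pairing pairing_proj₁ pairing_proj₂ fun f g m hf hg => by
      subst hf hg
      exact (pairing_projs m).symm
  fst_def _ _ := rfl
  snd_def _ _ := rfl

/-- The exchange of factors, as a coalgebra equivalence. -/
noncomputable def swap (C D : CocommCoalg k) :
    C.carrier ⊗[k] D.carrier ≃ₗc[k] D.carrier ⊗[k] C.carrier :=
  { TensorProduct.comm k C.carrier D.carrier with
    counit_comp := by ext; simp [mul_comm]
    map_comp_comul := by
      ext x y
      simp [← (Coalgebra.Repr.arbitrary k x).eq, ← (Coalgebra.Repr.arbitrary k y).eq,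
        TensorProduct.sum_tmul, TensorProduct.tmul_sum]
      exact Finset.sum_comm }

noncomputable instance : BraidedCategory (CocommCoalg k) :=
  BraidedCategory.ofFaithful (toMod k) (fun C D => isoMk (swap C D)) fun C D => by
    ext; rfl

noncomputable instance : (toMod k).Braided where
  braided C D := by ext; rfl

end CocommCoalg

namespace HopfGroup

open Coalgebra HopfAlgebra LinearMap WithConv

section antipode

variable {k H : Type*} [CommRing k] [Ring H] [HopfAlgebra k H]

/-- The antipode of a cocommutative Hopf algebra commutes with the comultiplication. -/
theorem comul_antipode [IsCocomm k H] :
    TensorProduct.map (antipode k (A := H)) (antipode k (A := H)) ∘ₗ comul =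
      comul ∘ₗ antipode k (A := H) := by
  have h₁ : toConv (TensorProduct.map (antipode k (A := H)) (antipode k (A := H)) ∘ₗ comul) *
      toConv (comul (R := k) (A := H)) = 1 := by
    have hh := TensorProduct.map_convMul_map (R := k) (f := toConv (antipode k (A := H)))
      (h := toConv (LinearMap.id (R := k) (M := H))) (g := toConv (antipode k (A := H)))
      (k := toConv (LinearMap.id (R := k) (M := H)))
    rw [antipode_mul_id] at hh
    have h := convMul_comp_coalgHom_distrib
      (toConv (TensorProduct.map (antipode k (A := H)) (antipode k (A := H))))
      (toConv (TensorProduct.map (LinearMap.id (R := k) (M := H)) (LinearMap.id (M := H))))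
      (comulCoalgHom k H)
    rw [hh] at h
    apply WithConv.ext
    rw [TensorProduct.map_id] at h
    refine h.symm.trans (LinearMap.ext fun x => ?_)
    have e : algebraMap k (H ⊗[k] H) (counit (R := k) x) =
        counit (R := k) x • ((1 : H) ⊗ₜ[k] (1 : H)) := by
      rw [Algebra.algebraMap_eq_smul_one]; rfl
    change TensorProduct.map (Algebra.linearMap k H ∘ₗ counit) (Algebra.linearMap k H ∘ₗ counit)
      (comul x) = algebraMap k (H ⊗[k] H) (counit (R := k) x)
    conv_rhs => rw [e, ← Coalgebra.sum_counit_smul (Coalgebra.Repr.arbitrary k x)]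
    rw [← (Coalgebra.Repr.arbitrary k x).eq]
    simp [Algebra.algebraMap_eq_smul_one, TensorProduct.smul_tmul', Finset.sum_smul, smul_smul,
      TensorProduct.tmul_smul, mul_comm]
  exact congrArg WithConv.ofConv (left_inv_eq_right_inv h₁ LinearMap.comul_right_inv)

variable (k H) in
/-- The antipode of a cocommutative Hopf algebra, as a coalgebra homomorphism. -/
noncomputable def antipodeCoalgHom [IsCocomm k H] : H →ₗc[k] H where
  toLinearMap := antipode k
  counit_comp := counit_comp_antipode
  map_comp_comul := comul_antipode

variable (k H) in
/-- The unit of a Hopf algebra, as a coalgebra homomorphism. -/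
noncomputable def unitCoalgHom : k →ₗc[k] H := (Bialgebra.unitBialgHom k H).toCoalgHom

end antipode

open scoped MonObj

variable {k : Type u} [CommRing k]

/-- The coalgebra underlying a cocommutative Hopf algebra. -/
abbrev coalg (k : Type u) [CommRing k] (H : Type u) [Ring H] [HopfAlgebra k H] [IsCocomm k H] :
    CocommCoalg k := ⟨H⟩

/-- A cocommutative Hopf algebra is a group object in cocommutative coalgebras. -/
noncomputable instance (H : Type u) [Ring H] [HopfAlgebra k H] [IsCocomm k H] :
    GrpObj (coalg k H) where
  one := ⟨unitCoalgHom k H⟩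
  mul := ⟨Bialgebra.mulCoalgHom k H⟩
  inv := ⟨antipodeCoalgHom k H⟩
  one_mul := by
    refine (CocommCoalg.toMod k).map_injective (ModuleCat.hom_ext (TensorProduct.ext' fun c x => ?_))
    exact (Algebra.smul_def (R := k) (A := H) c x).symm
  mul_one := by
    refine (CocommCoalg.toMod k).map_injective (ModuleCat.hom_ext (TensorProduct.ext' fun x c => ?_))
    exact (Algebra.commutes (R := k) (A := H) c x).symm.trans
      (Algebra.smul_def (R := k) (A := H) c x).symm
  mul_assoc := by
    refine (CocommCoalg.toMod k).map_injective (ModuleCat.hom_ext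
      (TensorProduct.ext_threefold fun x y z => ?_))
    exact mul_assoc (x : H) y z
  left_inv := CocommCoalg.hom_ext fun x => by
    exact mul_antipode_rTensor_comul_apply (R := k) (A := H) x
  right_inv := CocommCoalg.hom_ext fun x => by
    exact mul_antipode_lTensor_comul_apply (R := k) (A := H) x

/-- A homomorphism of cocommutative Hopf algebras, as a morphism of the underlying coalgebras. -/
abbrev coalgMap {H H' : Type u} [Ring H] [HopfAlgebra k H] [IsCocomm k H] [Ring H']
    [HopfAlgebra k H'] [IsCocomm k H'] (f : H →ₐc[k] H') : coalg k H ⟶ coalg k H' :=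
  ⟨f.toCoalgHom⟩

instance {H H' : Type u} [Ring H] [HopfAlgebra k H] [IsCocomm k H] [Ring H']
    [HopfAlgebra k H'] [IsCocomm k H'] (f : H →ₐc[k] H') : IsMonHom (coalgMap f) where
  one_hom := CocommCoalg.hom_ext fun x => by
    exact AlgHomClass.commutes f x
  mul_hom := by
    refine (CocommCoalg.toMod k).map_injective (ModuleCat.hom_ext (TensorProduct.ext' fun x y => ?_))
    exact map_mul f x y

end HopfGroup

open Functor.LaxMonoidal in
/-- The property of a lax symmetric monoidal functor `F` on `gr^op` that its structure morphisms
`k → F(0)` and `F(n) ⊗ F(m) → F(n + m)` are isomorphisms. -/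
def isStrong (k : Type u) [CommRing k] :
    ObjectProperty (LaxBraidedFunctor GrOp (ModuleCat.{u} k)) :=
  fun F => IsIso (ε F.toFunctor) ∧ ∀ X Y, IsIso (μ F.toFunctor X Y)

/-- The category of exponential `gr^op`-modules: (strong) symmetric monoidal functors from `gr^op`
to `k`-modules, with monoidal natural transformations as morphisms. -/
abbrev ExpMod (k : Type u) [CommRing k] := (isStrong k).FullSubcategory

/-- The property of a Hopf algebra to be cocommutative. -/
def isCocommHopf (k : Type u) [CommRing k] : ObjectProperty (HopfAlgCat.{u} k) :=
  fun H => Coalgebra.IsCocomm k H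

/-- The category of cocommutative Hopf algebras. -/
abbrev CocommHopf (k : Type u) [CommRing k] := (isCocommHopf k).FullSubcategory

namespace CocommHopf

variable {k : Type u} [CommRing k]

instance (H : CocommHopf k) : Coalgebra.IsCocomm k H.obj := H.property

/-- The group object in cocommutative coalgebras underlying a cocommutative Hopf algebra. -/
abbrev grp (H : CocommHopf k) : CocommCoalg k := HopfGroup.coalg k H.obj

/-- The functor `n ↦ H^{⊗ n}` on `gr^op`. The map induced by `[w_1 | ⋯ | w_m]_n` is the coalgebra
homomorphism `H^{⊗ n} → H^{⊗ m}` whose components are the words `w_j`, evaluated at the projections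
`H^{⊗ n} → H` in the convolution group of coalgebra homomorphisms. -/
noncomputable abbrev tensorPowers (H : CocommHopf k) : GrOp ⥤ ModuleCat.{u} k :=
  GrpPower.powFunctor H.grp ⋙ CocommCoalg.toMod k

/-- The natural transformation with components `f^{⊗ n}`. -/
noncomputable abbrev tensorPowersMap {H H' : CocommHopf k} (f : H ⟶ H') :
    H.tensorPowers ⟶ H'.tensorPowers :=
  Functor.whiskerRight (GrpPower.powTrans (HopfGroup.coalgMap f.hom.toBialgHom))
    (CocommCoalg.toMod k)

/-- The exponential module attached to `H`. -/
noncomputable def expMod (H : CocommHopf k) : ExpMod k where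
  obj := .of H.tensorPowers
  property := ⟨inferInstanceAs (IsIso (Functor.LaxMonoidal.ε H.tensorPowers)),
    fun X Y => inferInstanceAs (IsIso (Functor.LaxMonoidal.μ H.tensorPowers X Y))⟩

theorem isMonoidal {H H' : CocommHopf k} (f : H ⟶ H') : NatTrans.IsMonoidal (tensorPowersMap f) :=
  NatTrans.IsMonoidal.whiskerRight
    (τ := GrpPower.powTrans (HopfGroup.coalgMap f.hom.toBialgHom)) (G₁ := CocommCoalg.toMod k)

theorem tensorPowersMap_id (H : CocommHopf k) : tensorPowersMap (𝟙 H) = 𝟙 H.tensorPowers := by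
  have h (n : ℕ) : GrpPower.tupleLift n (fun i => GrpPower.proj H.grp n i ≫
      HopfGroup.coalgMap (InducedCategory.Hom.hom (𝟙 H)).toBialgHom) = 𝟙 (GrpPower.pow H.grp n) :=
    GrpPower.pow_ext n fun i => by
      rw [GrpPower.tupleLift_proj, Category.id_comp]
      exact Category.comp_id _
  ext X : 2
  exact (congrArg (CocommCoalg.toMod k).map (h X.rank)).trans (CategoryTheory.Functor.map_id _ _)

theorem tensorPowersMap_comp {H H' H'' : CocommHopf k} (f : H ⟶ H') (g : H' ⟶ H'') :
    tensorPowersMap (f ≫ g) = tensorPowersMap f ≫ tensorPowersMap g := by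
  have h (n : ℕ) : GrpPower.tupleLift n (fun i => GrpPower.proj H.grp n i ≫
        HopfGroup.coalgMap (f ≫ g).hom.toBialgHom) =
      GrpPower.tupleLift n (fun i => GrpPower.proj H.grp n i ≫
        HopfGroup.coalgMap f.hom.toBialgHom) ≫
      GrpPower.tupleLift n (fun i => GrpPower.proj H'.grp n i ≫
        HopfGroup.coalgMap g.hom.toBialgHom) :=
    GrpPower.pow_ext n fun i => by
      rw [Category.assoc, GrpPower.tupleLift_proj, GrpPower.tupleLift_proj, ← Category.assoc,
        GrpPower.tupleLift_proj, Category.assoc]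
      rfl
  ext X : 2
  exact (congrArg (CocommCoalg.toMod k).map (h X.rank)).trans
    (CategoryTheory.Functor.map_comp _ _ _)

variable (k) in
/-- The functor `α` from cocommutative Hopf algebras to exponential `gr^op`-modules, sending `H` to
`n ↦ H^{⊗ n}`. -/
noncomputable def alpha : CocommHopf k ⥤ ExpMod k where
  obj H := H.expMod
  map f := ⟨⟨⟨tensorPowersMap f, isMonoidal f⟩⟩⟩
  map_id H := ObjectProperty.hom_ext _ (LaxBraidedFunctor.hom_ext (tensorPowersMap_id H))
  map_comp f g := ObjectProperty.hom_ext _ (LaxBraidedFunctor.hom_ext (tensorPowersMap_comp f g))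

end CocommHopf

namespace GrModule

variable {k : Type u} [CommRing k]

/-- The linear map `F(f)` underlying the action of a morphism `f` of `gr^op`. -/
abbrev act (F : GrOp ⥤ ModuleCat.{u} k) {X Y : GrOp} (f : X ⟶ Y) : F.obj X →ₗ[k] F.obj Y :=
  (F.map f).hom

/-- The first cross-effect `cr^1(F)(X)`: the image of `id - F(p)`, where `p : X ⟶ 0 ⟶ X` is the zero
morphism. It is a subfunctor of `F`. -/
def crossEffectOne (F : GrOp ⥤ ModuleCat.{u} k) (X : GrOp) : Submodule k (F.obj X) :=
  LinearMap.range (LinearMap.id - act F (GrOp.zero X X))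

/-- The idempotent `χ = (id - F(p × id)) ∘ (id - F(id × p))` of `F(X + X)`, where `p : X ⟶ X` is the
zero morphism. -/
def chiTwo (F : GrOp ⥤ ModuleCat.{u} k) (X : GrOp) : F.obj (X ⊗ X) →ₗ[k] F.obj (X ⊗ X) :=
  (LinearMap.id - act F (GrOp.zero X X ⊗ₘ 𝟙 X)) ∘ₗ (LinearMap.id - act F (𝟙 X ⊗ₘ GrOp.zero X X))

/-- The part `P_1(F)(X)` of polynomial degree at most one: the kernel of
`F(X) → F(X + X) → F(X + X)`, the diagonal followed by `χ`. -/
def polyPartOne (F : GrOp ⥤ ModuleCat.{u} k) (X : GrOp) : Submodule k (F.obj X) :=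
  LinearMap.ker (chiTwo F X ∘ₗ act F (lift (𝟙 X) (𝟙 X)))

/-- `P_1(cr^1(F))(X)`. As `cr^1(F)` is a subfunctor of `F`, the kernel that defines `P_1` of it is
the intersection of `cr^1(F)(X)` with `P_1(F)(X)`. -/
def reducedPolyPartOne (F : GrOp ⥤ ModuleCat.{u} k) (X : GrOp) : Submodule k (F.obj X) :=
  crossEffectOne F X ⊓ polyPartOne F X

/-- The `gr^op`-module `X ↦ F(a + X + b)`. -/
abbrev shift (F : GrOp ⥤ ModuleCat.{u} k) (a b : ℕ) : GrOp ⥤ ModuleCat.{u} k :=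
  tensorLeft (⟨a⟩ : GrOp) ⋙ tensorRight (⟨b⟩ : GrOp) ⋙ F

theorem shift_eq {a b n : ℕ} (h : a + 1 + b = n) :
    (⟨n⟩ : GrOp) = ((⟨a⟩ : GrOp) ⊗ (⟨1⟩ : GrOp)) ⊗ (⟨b⟩ : GrOp) :=
  congrArg GrOp.mk h.symm

/-- The primitive part of `F`: the intersection, over all decompositions `n = a + 1 + b`, of the
submodules `P_1(cr^1(F(a + - + b)))(1)` of `F(n)`. -/
def primPart (F : GrOp ⥤ ModuleCat.{u} k) (n : ℕ) : Submodule k (F.obj ⟨n⟩) :=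
  ⨅ (a : ℕ) (b : ℕ) (h : a + 1 + b = n),
    (reducedPolyPartOne (shift F a b) ⟨1⟩).comap (act F (eqToHom (shift_eq h)))

/-- The standard basis of the module of morphisms `n → m` in the category associated with the operad
of unital associative algebras: `m`-tuples of words in `x_1, …, x_n` in which each variable occurs
exactly once altogether. -/
abbrev AssTuple (n m : ℕ) : Type :=
  {w : Fin m → List (Fin n) // ∀ i, ∑ j, (w j).count i = 1}

/-- The morphism `[w_1 | ⋯ | w_m]_n` of `gr^op` given by a tuple of words. -/
def AssTuple.toGrOp {n m : ℕ} (w : AssTuple n m) : (⟨n⟩ : GrOp) ⟶ (⟨m⟩ : GrOp) :=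
  GrOp.tuple (X := ⟨n⟩) (Y := ⟨m⟩) fun j => ((w.1 j).map FreeGroup.of).prod

/-- The map `I_n`, from the tensor product of the free module on `AssTuple n m` with the `n`-th
primitive part to `F(m)`, given by `w ⊗ v ↦ F([w_1 | ⋯ | w_m]_n)(v)`. -/
noncomputable def primAction (F : GrOp ⥤ ModuleCat.{u} k) (n m : ℕ) :
    (AssTuple n m →₀ k) ⊗[k] primPart F n →ₗ[k] F.obj ⟨m⟩ :=
  TensorProduct.lift (Finsupp.lift (primPart F n →ₗ[k] F.obj ⟨m⟩) k (AssTuple n m)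
    fun w => act F w.toGrOp ∘ₗ (primPart F n).subtype)

/-- The primitive filtration: `Q_n(F)(m)` is the image of the sum of the maps `I_l`, `l ≤ n`. -/
noncomputable def primFiltration (F : GrOp ⥤ ModuleCat.{u} k) (n m : ℕ) :
    Submodule k (F.obj ⟨m⟩) :=
  ⨆ l : Fin (n + 1), LinearMap.range (primAction F l m)

/-- `F` is primitive if it is the union (colimit) of its primitive filtration. -/
def IsPrimitive (F : GrOp ⥤ ModuleCat.{u} k) : Prop :=
  ∀ m : ℕ, ⨆ n : ℕ, primFiltration F n m = ⊤

end GrModule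

/-- The property of an exponential `gr^op`-module to be primitive. -/
def isPrimitiveExp (k : Type u) [CommRing k] : ObjectProperty (ExpMod k) :=
  fun F => GrModule.IsPrimitive F.obj.toFunctor

/-- The category of primitive exponential `gr^op`-modules. -/
abbrev PrimExpMod (k : Type u) [CommRing k] := (isPrimitiveExp k).FullSubcategory

namespace HopfPrim

variable (k H : Type u) [CommRing k] [Ring H] [HopfAlgebra k H]

/-- The submodule of primitive elements. -/
def primElements : Submodule k H where
  carrier := {a | Coalgebra.counit (R := k) a = 0 ∧
    Coalgebra.comul (R := k) a = a ⊗ₜ[k] 1 + 1 ⊗ₜ[k] a}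
  zero_mem' := by simp
  add_mem' := by
    rintro a b ⟨ha, ha'⟩ ⟨hb, hb'⟩
    refine ⟨by rw [map_add, ha, hb, add_zero], ?_⟩
    rw [map_add, ha', hb', TensorProduct.add_tmul, TensorProduct.tmul_add]
    abel
  smul_mem' := by
    rintro c a ⟨ha, ha'⟩
    refine ⟨by rw [map_smul, ha, smul_zero], ?_⟩
    rw [map_smul, ha', smul_add, TensorProduct.smul_tmul', TensorProduct.tmul_smul]

/-- The first term of the primitive filtration, the sum of `k · 1` and the primitive elements. -/
noncomputable def primOne : Submodule k H := Submodule.span k {1} ⊔ primElements k H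

/-- `H` is primitive (primitively generated) if it is the union of the powers of `primOne`. -/
def IsPrimitive : Prop := ⨆ n : ℕ, primOne k H ^ n = ⊤

end HopfPrim

/-- The property of a cocommutative Hopf algebra to be primitive. -/
def isPrimitiveHopf (k : Type u) [CommRing k] : ObjectProperty (CocommHopf k) :=
  fun H => HopfPrim.IsPrimitive k H.obj

/-- The category of primitive cocommutative Hopf algebras. -/
abbrev PrimCocommHopf (k : Type u) [CommRing k] := (isPrimitiveHopf k).FullSubcategory

/-! Full faithfulness of `α` needs no primitivity. A monoidal transformation `τ : α(H) → α(H')`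
satisfies `τ_{n+1} = τ_n ⊗ τ_1` up to the structure isomorphisms, so it is determined by its
component `f : H → H'` at `1` (`app_tmulLast`). The product, unit, counit and coproduct of `H` are
the actions of `[x_1 x_2]`, of `0 → 1`, of `1 → 0` and of the diagonal, so naturality along these
four morphisms makes `f` a bialgebra homomorphism; compatibility with antipodes is then automatic.

Primitive Hopf algebras give primitive modules. On the factor `H`, the operator `id - α(H)(p)` is
the projection onto the augmentation ideal, so the condition defining `P_1` is the vanishing of the
reduced coproduct, and `P_1(cr^1(α(H)))(1)` is `Prim(H)` (`oneEquiv_mem_reducedPolyPartOne`).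
Tensors of primitive elements therefore lie in the primitive part, and tuples of words multiply them
together; when `H` is generated by primitive elements, this reaches all of `H^{⊗ m}`
(`filtrationUnion_eq_top`).

Over a field the converse holds: if `α(H)` is primitive, so is `H`. By flatness and a dual basis
argument, the primitive part of `H^{⊗ n}` is contained in the span of the tensors of primitive
elements (`primPart_succ_le`). It thus lies in the image of `α(T) → α(H)`, where `T` is the tensor
algebra on `Prim(H)`. That image is a subfunctor, so it is everything, and `T → H` is onto
(`isPrimitive_of_isPrimitive_tensorPowers`).

Essential surjectivity of `α` holds over every ring. Each object of a category with finite products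
is a cocommutative comonoid, so a strong symmetric monoidal `F` lifts to cocommutative coalgebras,
where the lift preserves finite products. The object `1` is a group object of `gr^op`, since it
represents `n ↦ F_n`. Hence `F(1)` is a group object in coalgebras, that is a cocommutative Hopf
algebra, and `F` is its functor of powers (`isoTensorPowers`). Over a field, the preceding paragraph
shows that this Hopf algebra is primitive when `F` is. -/

namespace GrOp

/-! ### Morphisms of `gr^op` on generators -/

theorem toHom_fst (X Y : GrOp) (i : Fin X.rank) :
    toHom (fst X Y) (FreeGroup.of i) = FreeGroup.of (Fin.castAdd Y.rank i) :=
  toHom_tuple_of (X := ⟨X.rank + Y.rank⟩) (Y := X)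
    (fun i => FreeGroup.of (Fin.castAdd Y.rank i)) i

theorem toHom_snd (X Y : GrOp) (i : Fin Y.rank) :
    toHom (snd X Y) (FreeGroup.of i) = FreeGroup.of (Fin.natAdd X.rank i) :=
  toHom_tuple_of (X := ⟨X.rank + Y.rank⟩) (Y := Y)
    (fun i => FreeGroup.of (Fin.natAdd X.rank i)) i

theorem toHom_lift_castAdd {T X Y : GrOp} (f : T ⟶ X) (g : T ⟶ Y) (i : Fin X.rank) :
    toHom (lift f g) (FreeGroup.of (Fin.castAdd Y.rank i)) = toHom f (FreeGroup.of i) := by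
  rw [← toHom_fst]
  exact DFunLike.congr_fun (congrArg toHom (lift_fst f g)) (FreeGroup.of i)

theorem toHom_lift_natAdd {T X Y : GrOp} (f : T ⟶ X) (g : T ⟶ Y) (i : Fin Y.rank) :
    toHom (lift f g) (FreeGroup.of (Fin.natAdd X.rank i)) = toHom g (FreeGroup.of i) := by
  rw [← toHom_snd]
  exact DFunLike.congr_fun (congrArg toHom (lift_snd f g)) (FreeGroup.of i)

@[simp]
theorem toHom_zero (X Y : GrOp) (x : Y.free) : toHom (zero X Y) x = 1 := by
  induction x using FreeGroup.induction_on with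
  | C1 => simp
  | of i => exact toHom_tuple_of _ _
  | inv_of i h => rw [map_inv, h, inv_one]
  | mul x y hx hy => rw [map_mul, hx, hy, one_mul]

theorem toHom_eqToHom {X Y : GrOp} (h : X = Y) (i : Fin Y.rank) :
    toHom (eqToHom h) (FreeGroup.of i) = FreeGroup.of (Fin.cast (congrArg rank h.symm) i) := by
  subst h
  rfl

end GrOp

/-! ### Structure maps on the powers of a group object -/

namespace GrpPower

open scoped MonObj

universe v w

variable {C : Type w} [Category.{v} C] [CartesianMonoidalCategory C] (G : C)

/-- The isomorphism `G ⟶ G^1`. -/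
def single : G ⟶ pow G 1 := (λ_ G).inv

theorem single_last : single G ≫ last G 0 = 𝟙 G := leftUnitor_inv_snd G

variable [GrpObj G]

theorem powMap_fst_one (X : GrOp) : powMap G (fst X (⟨1⟩ : GrOp)) = front G X.rank :=
  pow_ext _ fun i => by
    rw [powMap_proj, GrOp.toHom_fst]
    exact FreeGroup.lift_apply_of.trans (proj_castSucc G X.rank i)

theorem powMap_snd_one (X : GrOp) :
    powMap G (snd X (⟨1⟩ : GrOp)) = last G X.rank ≫ (λ_ G).inv :=
  pow_ext 1 fun i => by
    obtain rfl : i = Fin.last 0 := Subsingleton.elim _ _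
    rw [powMap_proj, GrOp.toHom_snd]
    refine (FreeGroup.lift_apply_of.trans (proj_last G X.rank)).trans ?_
    rw [proj_last]
    exact ((Category.assoc _ _ _).trans
      ((last G X.rank ≫= leftUnitor_inv_snd G).trans (Category.comp_id _))).symm

theorem delta_one [BraidedCategory C] (X : GrOp) :
    Functor.OplaxMonoidal.δ (powFunctor G) X (⟨1⟩ : GrOp) = pow G X.rank ◁ (λ_ G).inv :=
  CartesianMonoidalCategory.hom_ext (X := pow G X.rank) (Y := 𝟙_ C ⊗ G) _ _
    ((Functor.OplaxMonoidal.δ_fst _ _ _).trans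
      ((powMap_fst_one G X).trans (whiskerLeft_fst _ _).symm))
    ((Functor.OplaxMonoidal.δ_snd _ _ _).trans
      ((powMap_snd_one G X).trans (whiskerLeft_snd _ _).symm))

/-- The power `G^1` is `𝟙 ⊗ G` and not `G`, so a left unitor remains. This identifies `G^{n+1}` with
the product of `G^n` and `G^1` by the monoidal structure, which is what inductions on `n` use. -/
theorem mu_one [BraidedCategory C] (X : GrOp) :
    Functor.LaxMonoidal.μ (powFunctor G) X (⟨1⟩ : GrOp) = pow G X.rank ◁ (λ_ G).hom := by
  have h : (pow G X.rank ◁ (λ_ G).hom) ≫ Functor.OplaxMonoidal.δ (powFunctor G) X (⟨1⟩ : GrOp) =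
      𝟙 (pow G X.rank ⊗ (𝟙_ C ⊗ G)) := by
    rw [delta_one]
    exact (whiskerLeft_comp _ _ _).symm.trans
      ((congrArg _ (λ_ G).hom_inv_id).trans (whiskerLeft_id _ _))
  exact (Category.id_comp _).symm.trans ((h.symm =≫ _).trans ((Category.assoc _ _ _).trans
    ((_ ≫= Functor.Monoidal.δ_μ (powFunctor G) X (⟨1⟩ : GrOp)).trans (Category.comp_id _))))

/-- The morphism `[x_1 | ⋯ | x_n | x_{n+1} x_{n+2}] : n + 2 ⟶ n + 1` of `gr^op`. -/
def mulLast (n : ℕ) : (⟨n + 2⟩ : GrOp) ⟶ (⟨n + 1⟩ : GrOp) :=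
  GrOp.tuple (X := ⟨n + 2⟩) (Y := ⟨n + 1⟩) <| Fin.lastCases
    (FreeGroup.of (Fin.last n).castSucc * FreeGroup.of (Fin.last (n + 1)))
    fun i => FreeGroup.of i.castSucc.castSucc

/-- The multiplication of the last two factors. -/
def mulLastTwo (n : ℕ) : pow G (n + 2) ⟶ pow G (n + 1) :=
  (α_ (pow G n) G G).hom ≫ pow G n ◁ μ[G]

theorem mulLastTwo_front (n : ℕ) :
    mulLastTwo G n ≫ front G n = front G (n + 1) ≫ front G n := by
  change ((α_ (pow G n) G G).hom ≫ pow G n ◁ μ[G]) ≫ fst (pow G n) G =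
    fst (pow G n ⊗ G) G ≫ fst (pow G n) G
  simp

theorem mulLastTwo_last (n : ℕ) :
    mulLastTwo G n ≫ last G n = (front G (n + 1) ≫ last G n) * last G (n + 1) := by
  change ((α_ (pow G n) G G).hom ≫ pow G n ◁ μ[G]) ≫ snd (pow G n) G =
    lift (fst (pow G n ⊗ G) G ≫ snd (pow G n) G) (snd (pow G n ⊗ G) G) ≫ μ[G]
  rw [Category.assoc, whiskerLeft_snd, ← Category.assoc]
  congr 1
  ext <;> simp

theorem powMap_mulLast (n : ℕ) : powMap G (mulLast n) = mulLastTwo G n := by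
  refine pow_ext (n + 1) fun i => ?_
  rw [powMap_proj, mulLast, GrOp.toHom_tuple_of]
  induction i using Fin.lastCases with
  | last =>
    rw [Fin.lastCases_last, proj_last, mulLastTwo_last, map_mul, FreeGroup.lift_apply_of,
      FreeGroup.lift_apply_of, proj_castSucc, proj_last, proj_last]
  | cast i =>
    rw [Fin.lastCases_castSucc, proj_castSucc, ← Category.assoc, mulLastTwo_front,
      FreeGroup.lift_apply_of, proj_castSucc, proj_castSucc, Category.assoc]

theorem single_powMap_zero_zero : single G ≫ powMap G (GrOp.zero ⟨1⟩ ⟨0⟩) = toUnit G :=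
  toUnit_unique _ _

theorem powMap_zero_zero_one : powMap G (GrOp.zero ⟨0⟩ ⟨1⟩) = η[G] ≫ single G :=
  succ_ext (toUnit_unique _ _) <| by
    have h := powMap_proj G (GrOp.zero ⟨0⟩ ⟨1⟩) (Fin.last 0)
    rw [GrOp.toHom_zero, map_one, proj_last] at h
    refine h.trans (Eq.trans ?_
      ((Category.assoc _ _ _).trans ((η[G] ≫= single_last G).trans (Category.comp_id _))).symm)
    exact (toUnit_unique _ (𝟙 _) =≫ η[G]).trans (Category.id_comp _)

theorem single_powMap_diag :
    single G ≫ powMap G (lift (𝟙 (⟨1⟩ : GrOp)) (𝟙 (⟨1⟩ : GrOp))) = snoc (single G) (𝟙 G) := by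
  have h (i : Fin 2) : powMap G (lift (𝟙 (⟨1⟩ : GrOp)) (𝟙 (⟨1⟩ : GrOp))) ≫ proj G 2 i = last G 0 := by
    refine (powMap_proj G (lift (𝟙 (⟨1⟩ : GrOp)) (𝟙 (⟨1⟩ : GrOp))) i).trans ?_
    induction i using Fin.addCases (m := 1) (n := 1) with
    | left i =>
      obtain rfl : i = Fin.last 0 := Subsingleton.elim _ _
      erw [GrOp.toHom_lift_castAdd]
      exact FreeGroup.lift_apply_of.trans (proj_last G 0)
    | right i =>
      obtain rfl : i = Fin.last 0 := Subsingleton.elim _ _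
      erw [GrOp.toHom_lift_natAdd]
      exact FreeGroup.lift_apply_of.trans (proj_last G 0)
  have h₀ := h (Fin.last 0).castSucc
  have h₁ := h (Fin.last 1)
  rw [proj_castSucc, proj_last] at h₀
  rw [proj_last] at h₁
  refine succ_ext (succ_ext (toUnit_unique _ _) ?_) ?_
  · rw [snoc_front]
    exact (Category.assoc _ _ _).trans ((Category.assoc _ _ _).trans (single G ≫= h₀))
  · rw [snoc_last]
    exact (Category.assoc _ _ _).trans ((single G ≫= h₁).trans (single_last G))

end GrpPower

/-! ### The operations of `H` as actions of morphisms of `gr^op` -/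

namespace CocommHopf

open GrModule GrpPower

variable {k : Type u} [CommRing k] (H : CocommHopf k)

/-- The unit of `H^{⊗ 0} = k`. -/
def unitElt : H.tensorPowers.obj ⟨0⟩ := (1 : k)

/-- The map `(v, h) ↦ v ⊗ h` from `H^{⊗ n} × H` to `H^{⊗ (n + 1)}`. -/
noncomputable def tmulLast (n : ℕ) :
    H.tensorPowers.obj ⟨n⟩ →ₗ[k] H.obj →ₗ[k] H.tensorPowers.obj ⟨n + 1⟩ :=
  TensorProduct.mk k (pow H.grp n).carrier H.obj

/-- The isomorphism `h ↦ 1 ⊗ h` from `H` to `H^{⊗ 1}`. -/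
noncomputable def oneEquiv : H.obj ≃ₗ[k] H.tensorPowers.obj ⟨1⟩ := (TensorProduct.lid k H.obj).symm

variable {H}

theorem oneEquiv_apply (h : H.obj) : H.oneEquiv h = H.tmulLast 0 H.unitElt h := rfl

theorem hom_ext_zero {M : Type*} [AddCommGroup M] [Module k M]
    {f g : H.tensorPowers.obj ⟨0⟩ →ₗ[k] M} (h : f H.unitElt = g H.unitElt) : f = g :=
  LinearMap.ext_ring (M₃ := M) (R := k) h

theorem hom_ext_succ {M : Type*} [AddCommGroup M] [Module k M] {n : ℕ}
    {f g : H.tensorPowers.obj ⟨n + 1⟩ →ₗ[k] M}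
    (h : ∀ v x, f (H.tmulLast n v x) = g (H.tmulLast n v x)) : f = g :=
  TensorProduct.ext' (M := (pow H.grp n).carrier) (N := H.obj) h

/-- Translates conditions on `μ`, such as monoidality of a transformation or naturality of `μ`, into
conditions on tensors `v ⊗ x`. -/
theorem mu_tmul (n : ℕ) (v : H.tensorPowers.obj ⟨n⟩) (x : H.obj) :
    (Functor.LaxMonoidal.μ H.tensorPowers ⟨n⟩ ⟨1⟩).hom (v ⊗ₜ[k] H.oneEquiv x) =
      H.tmulLast n v x := by
  have h := congrArg (CocommCoalg.toMod k).map (mu_one H.grp ⟨n⟩)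
  have h' : Functor.LaxMonoidal.μ H.tensorPowers ⟨n⟩ ⟨1⟩ =
      (CocommCoalg.toMod k).map (pow H.grp n ◁ (λ_ H.grp).hom) :=
    (Category.id_comp _).trans h
  rw [h']
  change v ⊗ₜ[k] ((1 : k) • x) = v ⊗ₜ[k] x
  rw [one_smul]

theorem epsilon_one : (Functor.LaxMonoidal.ε H.tensorPowers).hom (1 : k) = H.unitElt := by
  have h : Functor.LaxMonoidal.ε (powFunctor H.grp) = 𝟙 (𝟙_ (CocommCoalg k)) := toUnit_unique _ _
  have h' : Functor.LaxMonoidal.ε H.tensorPowers =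
      (CocommCoalg.toMod k).map (𝟙 (𝟙_ (CocommCoalg k))) := by
    rw [← h]
    exact Category.id_comp _
  rw [h']
  rfl

/-- The spectator factor `v` is carried along because the same formula is needed inside `H^{⊗
(m+1)}` to multiply the last factor by a primitive element. -/
theorem act_mulLast (n : ℕ) (v : H.tensorPowers.obj ⟨n⟩) (x y : H.obj) :
    act H.tensorPowers (mulLast n) (H.tmulLast (n + 1) (H.tmulLast n v x) y) =
      H.tmulLast n v (x * y) :=
  DFunLike.congr_fun (congrArg (fun f => f.toCoalgHom.toLinearMap) (powMap_mulLast H.grp n))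
    (H.tmulLast (n + 1) (H.tmulLast n v x) y)

theorem act_zero_zero_one :
    act H.tensorPowers (GrOp.zero ⟨0⟩ ⟨1⟩) H.unitElt = H.oneEquiv 1 :=
  (DFunLike.congr_fun (congrArg (fun f => f.toCoalgHom.toLinearMap)
    (powMap_zero_zero_one H.grp)) H.unitElt).trans
    (congrArg H.oneEquiv (map_one (algebraMap k H.obj)))

theorem act_zero_one_zero (x : H.obj) :
    act H.tensorPowers (GrOp.zero ⟨1⟩ ⟨0⟩) (H.oneEquiv x) =
      Coalgebra.counit (R := k) x • H.unitElt :=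
  (DFunLike.congr_fun (congrArg (fun f => f.toCoalgHom.toLinearMap)
    (single_powMap_zero_zero H.grp)) x).trans (mul_one (Coalgebra.counit (R := k) x)).symm

theorem act_diag (x : H.obj) :
    act H.tensorPowers (lift (𝟙 (⟨1⟩ : GrOp)) (𝟙 (⟨1⟩ : GrOp))) (H.oneEquiv x) =
      TensorProduct.lift (H.tmulLast 1 ∘ₗ H.oneEquiv.toLinearMap) (Coalgebra.comul (R := k) x) := by
  refine (DFunLike.congr_fun (congrArg (fun f => f.toCoalgHom.toLinearMap)
    (single_powMap_diag H.grp)) x).trans ?_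
  change TensorProduct.map H.oneEquiv.toLinearMap LinearMap.id (Coalgebra.comul (R := k) x) = _
  rfl

end CocommHopf

namespace GrModule

variable {k : Type u} [CommRing k] {F F' : GrOp ⥤ ModuleCat.{u} k}

theorem naturality_apply (τ : F ⟶ F') {X Y : GrOp} (f : X ⟶ Y) (v : F.obj X) :
    (τ.app Y).hom (act F f v) = act F' f ((τ.app X).hom v) :=
  DFunLike.congr_fun (congrArg ModuleCat.Hom.hom (τ.naturality f)) v

end GrModule

/-! ### Full faithfulness of `α` -/

namespace CocommHopf

open GrModule GrpPower

variable {k : Type u} [CommRing k] {H H' : CocommHopf k}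

theorem tensorPowersMap_app_zero (f : H ⟶ H') :
    ((tensorPowersMap f).app ⟨0⟩).hom H.unitElt = H'.unitElt := rfl

theorem tupleLift_succ_eq_tensorHom {C : Type*} [Category C] [CartesianMonoidalCategory C]
    {G G' : C} (f : G ⟶ G') (n : ℕ) :
    (tupleLift (n + 1) fun i => proj G (n + 1) i ≫ f) =
      ((tupleLift n fun i => proj G n i ≫ f) ⊗ₘ f : pow G n ⊗ G ⟶ pow G' n ⊗ G') := by
  refine succ_ext ?_ ?_
  · refine (snoc_front _ _).trans (Eq.trans ?_ (tensorHom_fst _ _).symm)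
    refine pow_ext n fun i => (tupleLift_proj _ _ _).trans ?_
    refine (proj_castSucc G n i =≫ f).trans ((Category.assoc _ _ _).trans ?_)
    exact ((Category.assoc _ _ _).trans 
      (front G n ≫= tupleLift_proj n (fun i => proj G n i ≫ f) i)).symm
  · exact (snoc_last _ _).trans ((proj_last G n =≫ f).trans (tensorHom_snd _ _).symm)

theorem tensorPowersMap_app_succ (f : H ⟶ H') (n : ℕ) (v : H.tensorPowers.obj ⟨n⟩) (x : H.obj) :
    ((tensorPowersMap f).app ⟨n + 1⟩).hom (H.tmulLast n v x) =
      H'.tmulLast n (((tensorPowersMap f).app ⟨n⟩).hom v) (f.hom.toBialgHom x) :=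
  DFunLike.congr_fun (congrArg (fun g => g.toCoalgHom.toLinearMap)
    (tupleLift_succ_eq_tensorHom (HopfGroup.coalgMap f.hom.toBialgHom) n)) (H.tmulLast n v x)

theorem tensorPowersMap_app_one (f : H ⟶ H') (x : H.obj) :
    ((tensorPowersMap f).app ⟨1⟩).hom (H.oneEquiv x) = H'.oneEquiv (f.hom.toBialgHom x) :=
  tensorPowersMap_app_succ f 0 H.unitElt x

section full

variable (τ : H.tensorPowers ⟶ H'.tensorPowers)

/-- The linear map `H → H'` underlying a natural transformation. -/
noncomputable def component : H.obj →ₗ[k] H'.obj :=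
  H'.oneEquiv.symm.toLinearMap ∘ₗ (τ.app ⟨1⟩).hom ∘ₗ H.oneEquiv.toLinearMap

theorem app_oneEquiv (x : H.obj) :
    (τ.app ⟨1⟩).hom (H.oneEquiv x) = H'.oneEquiv (component τ x) :=
  (H'.oneEquiv.apply_symm_apply _).symm

variable [NatTrans.IsMonoidal τ]

theorem app_unitElt : (τ.app ⟨0⟩).hom H.unitElt = H'.unitElt := by
  have h := DFunLike.congr_fun (congrArg ModuleCat.Hom.hom (NatTrans.IsMonoidal.unit (τ := τ)))
    (1 : k)
  rw [← epsilon_one, ← epsilon_one]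
  exact h

/-- Monoidality at the pair `(n, 1)`; by induction it makes `τ` the tensor powers of its component
at `1`. -/
theorem app_tmulLast (n : ℕ) (v : H.tensorPowers.obj ⟨n⟩) (x : H.obj) :
    (τ.app ⟨n + 1⟩).hom (H.tmulLast n v x) =
      H'.tmulLast n ((τ.app ⟨n⟩).hom v) (component τ x) := by
  have h := DFunLike.congr_fun (congrArg ModuleCat.Hom.hom
    (NatTrans.IsMonoidal.tensor (τ := τ) ⟨n⟩ ⟨1⟩)) (v ⊗ₜ[k] H.oneEquiv x)
  rw [← mu_tmul, ← mu_tmul, ← app_oneEquiv]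
  exact h

theorem component_mul (x y : H.obj) :
    component τ (x * y) = component τ x * component τ y := by
  apply H'.oneEquiv.injective
  -- The product `x y` is the action of `[x_1 x_2]` on `1 ⊗ x ⊗ y`, and `τ` commutes with this
  -- action.
  rw [← app_oneEquiv, oneEquiv_apply, ← act_mulLast, naturality_apply, app_tmulLast, app_tmulLast,
    app_unitElt, act_mulLast]
  rfl

theorem component_one : component τ (1 : H.obj) = 1 := by
  apply H'.oneEquiv.injective
  rw [← app_oneEquiv, ← act_zero_zero_one, naturality_apply, app_unitElt, act_zero_zero_one]

theorem unitElt_smul_injective {a b : k} (h : a • H.unitElt = b • H.unitElt) : a = b := by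
  have h' : a * 1 = b * 1 := h
  simpa using h'

theorem counit_component (x : H.obj) :
    Coalgebra.counit (R := k) (component τ x) = Coalgebra.counit (R := k) x := by
  apply unitElt_smul_injective (H := H')
  rw [← act_zero_one_zero, ← app_oneEquiv, ← naturality_apply, act_zero_one_zero, map_smul,
    app_unitElt]

theorem lift_tmulLast_injective :
    Function.Injective (TensorProduct.lift (H.tmulLast 1 ∘ₗ H.oneEquiv.toLinearMap)) := by
  have h : TensorProduct.lift (H.tmulLast 1 ∘ₗ H.oneEquiv.toLinearMap) =
      (TensorProduct.congr H.oneEquiv (LinearEquiv.refl k H.obj)).toLinearMap := rfl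
  rw [h]
  exact LinearEquiv.injective _

theorem comul_component (x : H.obj) :
    TensorProduct.map (component τ) (component τ) (Coalgebra.comul (R := k) x) =
      Coalgebra.comul (R := k) (component τ x) := by
  apply lift_tmulLast_injective
  -- Naturality along the diagonal `1 → 2` reduces the claim to `τ_2 = f ⊗ f` on pure tensors.
  rw [← act_diag, ← app_oneEquiv, ← naturality_apply, act_diag]
  induction Coalgebra.comul (R := k) x using TensorProduct.induction_on with
  | zero => simp
  | add a b ha hb => simp only [map_add, ha, hb]
  | tmul a b =>
    simp only [TensorProduct.map_tmul, TensorProduct.lift.tmul, LinearMap.comp_apply,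
      LinearEquiv.coe_coe]
    exact ((app_tmulLast τ 1 _ b).trans (by rw [app_oneEquiv])).symm

/-- The homomorphism of Hopf algebras underlying a monoidal transformation. -/
noncomputable def componentHom : H ⟶ H' :=
  ObjectProperty.homMk (HopfAlgCat.ofHom (BialgHom.ofAlgHom
    (AlgHom.ofLinearMap (component τ) (component_one τ) (component_mul τ))
    (AlgHom.ext fun x => counit_component τ x)
    (AlgHom.ext fun x => comul_component τ x)))

theorem componentHom_apply (x : H.obj) :
    (componentHom τ).hom.toBialgHom x = component τ x := rfl

theorem tensorPowersMap_componentHom : tensorPowersMap (componentHom τ) = τ := by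
  ext ⟨n⟩ : 3
  induction n with
  | zero => exact hom_ext_zero ((tensorPowersMap_app_zero _).trans (app_unitElt τ).symm)
  | succ n ih =>
    refine hom_ext_succ fun v x => ?_
    rw [tensorPowersMap_app_succ, app_tmulLast, componentHom_apply, ih]

end full

instance : (alpha k).Full where
  map_surjective {H H'} τ :=
    have : NatTrans.IsMonoidal (F₁ := H.tensorPowers) (F₂ := H'.tensorPowers) τ.hom.hom.hom :=
      τ.hom.hom.isMonoidal
    ⟨componentHom (H := H) (H' := H') τ.hom.hom.hom, ObjectProperty.hom_ext _
      (LaxBraidedFunctor.hom_ext (tensorPowersMap_componentHom (H := H) (H' := H') τ.hom.hom.hom))⟩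

instance : (alpha k).Faithful where
  map_injective {H H'} f g h := by
    have h' : tensorPowersMap f = tensorPowersMap g := congrArg (fun τ => τ.hom.hom.hom) h
    refine ObjectProperty.hom_ext _ (HopfAlgCat.hom_ext _ _ (BialgHom.ext fun x => ?_))
    apply H'.oneEquiv.injective
    exact (tensorPowersMap_app_one f x).symm.trans
      ((congrArg (fun τ : H.tensorPowers ⟶ H'.tensorPowers => (τ.app ⟨1⟩).hom (H.oneEquiv x)) h').trans
        (tensorPowersMap_app_one g x))

end CocommHopf

/-! ### Functoriality of the primitive part -/

namespace GrOp

/-- The primitive part is defined with transports along equalities `a + 1 + b = n`, whereas natural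
transformations between shifted functors involve associators and unitors. This lemma and the next
one reconcile the two. -/
theorem associator_hom_eq_eqToHom (X Y Z : GrOp)
    (h : (X ⊗ Y) ⊗ Z = X ⊗ (Y ⊗ Z)) : (α_ X Y Z).hom = eqToHom h := by
  refine CartesianMonoidalCategory.hom_ext _ _ ?_ (CartesianMonoidalCategory.hom_ext _ _ ?_ ?_)
  · rw [associator_hom_fst]
    ext i
    rw [toHom_comp, toHom_comp, MonoidHom.comp_apply, MonoidHom.comp_apply, toHom_fst, toHom_fst]
    exact (toHom_fst (X ⊗ Y) Z (Fin.castAdd Y.rank i)).trans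
      (toHom_eqToHom h (Fin.castAdd (Y ⊗ Z).rank i)).symm
  · rw [Category.assoc, associator_hom_snd_fst]
    ext i
    simp only [toHom_comp, MonoidHom.comp_apply, toHom_fst, toHom_snd]
    refine (toHom_fst (X ⊗ Y) Z (Fin.natAdd X.rank i)).trans (Eq.symm ?_)
    exact (congrArg _ (toHom_snd X (Y ⊗ Z) (Fin.castAdd Z.rank i))).trans
      (toHom_eqToHom h (Fin.natAdd X.rank (Fin.castAdd Z.rank i)))
  · rw [Category.assoc, associator_hom_snd_snd]
    ext i
    simp only [toHom_comp, MonoidHom.comp_apply, toHom_snd]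
    refine Eq.trans ?_ ((congrArg _ (toHom_snd X (Y ⊗ Z) (Fin.natAdd Y.rank i))).trans
      (toHom_eqToHom h (Fin.natAdd X.rank (Fin.natAdd Y.rank i)))).symm
    exact congrArg (FreeGroup.of (α := Fin (X.rank + Y.rank + Z.rank)))
      (Fin.ext (Nat.add_assoc X.rank Y.rank i))

theorem rightUnitor_inv_eq_eqToHom (X : GrOp) (h : X = X ⊗ 𝟙_ GrOp) :
    (ρ_ X).inv = eqToHom h := by
  rw [← cancel_mono (ρ_ X).hom, Iso.inv_hom_id, rightUnitor_hom]
  ext i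
  simp only [toHom_id, toHom_comp, MonoidHom.comp_apply, toHom_fst]
  exact (toHom_eqToHom h (Fin.castAdd _ i)).symm

end GrOp

namespace GrModule

variable {k : Type u} [CommRing k] {F F' : GrOp ⥤ ModuleCat.{u} k}

theorem act_comp {X Y Z : GrOp} (f : X ⟶ Y) (g : Y ⟶ Z) (v : F.obj X) :
    act F (f ≫ g) v = act F g (act F f v) := by
  rw [act, F.map_comp]
  rfl

theorem act_id {X : GrOp} (v : F.obj X) : act F (𝟙 X) v = v := by
  rw [act, F.map_id]
  rfl

theorem chiTwo_naturality (τ : F ⟶ F') (X : GrOp) (v : F.obj (X ⊗ X)) :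
    (τ.app (X ⊗ X)).hom (chiTwo F X v) = chiTwo F' X ((τ.app (X ⊗ X)).hom v) := by
  simp only [chiTwo, LinearMap.comp_apply, LinearMap.sub_apply, LinearMap.id_apply, map_sub,
    naturality_apply]

/-- `P_1(cr^1(F))` is built from actions of morphisms, so it is functorial in `F`. Memberships in
primitive parts are transported below by exhibiting a suitable transformation between shifts of
functors. -/
theorem app_mem_reducedPolyPartOne (τ : F ⟶ F') {X : GrOp} {v : F.obj X}
    (hv : v ∈ reducedPolyPartOne F X) : (τ.app X).hom v ∈ reducedPolyPartOne F' X := by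
  obtain ⟨⟨w, rfl⟩, hv⟩ := hv
  refine ⟨⟨(τ.app X).hom w, ?_⟩, ?_⟩
  · simp only [LinearMap.sub_apply, LinearMap.id_apply, map_sub, naturality_apply]
  · have h : chiTwo F X (act F (lift (𝟙 X) (𝟙 X)) _) = 0 := hv
    change chiTwo F' X (act F' (lift (𝟙 X) (𝟙 X)) _) = 0
    rw [← naturality_apply, ← chiTwo_naturality, h, map_zero]

theorem mem_primPart {n : ℕ} {v : F.obj ⟨n⟩} : v ∈ primPart F n ↔
    ∀ (a b : ℕ) (h : a + 1 + b = n),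
      act F (eqToHom (shift_eq h)) v ∈ reducedPolyPartOne (shift F a b) ⟨1⟩ := by
  simp [primPart, Submodule.mem_iInf]

theorem app_mem_primPart (τ : F ⟶ F') {n : ℕ} {v : F.obj ⟨n⟩} (hv : v ∈ primPart F n) :
    (τ.app ⟨n⟩).hom v ∈ primPart F' n := by
  rw [mem_primPart] at hv ⊢
  intro a b h
  rw [← naturality_apply]
  exact app_mem_reducedPolyPartOne (Functor.whiskerLeft (tensorLeft (⟨a⟩ : GrOp) ⋙
    tensorRight (⟨b⟩ : GrOp)) τ) (hv a b h)

theorem primAction_tmul {n m : ℕ} (w : AssTuple n m) (v : primPart F n) :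
    primAction F n m (Finsupp.single w 1 ⊗ₜ[k] v) = act F w.toGrOp v := by
  simp [primAction]

theorem range_primAction (F : GrOp ⥤ ModuleCat.{u} k) (n m : ℕ) :
    LinearMap.range (primAction F n m) =
      ⨆ w : AssTuple n m, (primPart F n).map (act F w.toGrOp) := by
  refine le_antisymm ?_ (iSup_le fun w => ?_)
  · rintro _ ⟨t, rfl⟩
    induction t using TensorProduct.induction_on with
    | zero => simp
    | add x y hx hy =>
      rw [map_add]
      exact add_mem hx hy
    | tmul x v =>
      induction x using Finsupp.induction_linear with
      | zero => simp
      | add x y hx hy =>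
        rw [TensorProduct.add_tmul, map_add]
        exact add_mem hx hy
      | single w c =>
        have h : Finsupp.single w c ⊗ₜ[k] v = c • (Finsupp.single w (1 : k) ⊗ₜ[k] v) := by
          rw [TensorProduct.smul_tmul', Finsupp.smul_single, smul_eq_mul, mul_one]
        rw [h, map_smul, primAction_tmul]
        exact Submodule.smul_mem _ _ (Submodule.mem_iSup_of_mem w ⟨v, v.2, rfl⟩)
  · rintro _ ⟨v, hv, rfl⟩
    exact ⟨_, primAction_tmul w ⟨v, hv⟩⟩

theorem iSup_primFiltration (F : GrOp ⥤ ModuleCat.{u} k) (m : ℕ) :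
    ⨆ n, primFiltration F n m =
      ⨆ (n : ℕ) (w : AssTuple n m), (primPart F n).map (act F w.toGrOp) := by
  simp only [← range_primAction, primFiltration]
  refine le_antisymm (iSup_le fun n => iSup_le fun l => le_iSup_of_le (l : ℕ) le_rfl)
    (iSup_le fun n => le_iSup_of_le n (le_iSup_of_le (Fin.last n) le_rfl))

/-- The forward map of the isomorphism sends the primitive filtration of `F` into that of `F'`, and
every element of `F'(m)` is the image of an element of `F(m)`. -/
theorem IsPrimitive.of_iso (e : F ≅ F') (h : IsPrimitive F) : IsPrimitive F' := by
  intro m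
  rw [eq_top_iff]
  rintro v -
  have hv : (e.inv.app ⟨m⟩).hom v ∈ ⨆ n, primFiltration F n m := h m ▸ Submodule.mem_top
  have hle : ⨆ n, primFiltration F n m ≤
      (⨆ n, primFiltration F' n m).comap (e.hom.app ⟨m⟩).hom := by
    rw [iSup_primFiltration, iSup_primFiltration]
    refine iSup_le fun n => iSup_le fun w => ?_
    rintro _ ⟨x, hx, rfl⟩
    rw [Submodule.mem_comap, naturality_apply]
    exact Submodule.mem_iSup_of_mem n (Submodule.mem_iSup_of_mem w
      ⟨_, app_mem_primPart e.hom hx, rfl⟩)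
  have h' : (e.hom.app ⟨m⟩).hom ((e.inv.app ⟨m⟩).hom v) = v :=
    DFunLike.congr_fun (congrArg ModuleCat.Hom.hom (e.inv_hom_id_app ⟨m⟩)) v
  exact h' ▸ hle hv

section monoidal

open Functor.LaxMonoidal

variable (F) [F.LaxMonoidal]

/-- The natural transformation `v ↦ v ⊗ w` given by an element `w` of a monoidal functor. -/
noncomputable def mulRight {Z : GrOp} (w : F.obj Z) : F ⟶ tensorRight Z ⋙ F where
  app X := ModuleCat.ofHom ((μ F X Z).hom ∘ₗ (TensorProduct.mk k (F.obj X) (F.obj Z)).flip w)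
  naturality _ _ f := ModuleCat.hom_ext <| LinearMap.ext fun v =>
    DFunLike.congr_fun (congrArg ModuleCat.Hom.hom (μ_natural_left F f Z)) (v ⊗ₜ[k] w)

/-- The natural transformation `w ↦ v ⊗ w` given by an element `v` of a monoidal functor. -/
noncomputable def mulLeft {Z : GrOp} (v : F.obj Z) : F ⟶ tensorLeft Z ⋙ F where
  app X := ModuleCat.ofHom ((μ F Z X).hom ∘ₗ TensorProduct.mk k (F.obj Z) (F.obj X) v)
  naturality _ _ f := ModuleCat.hom_ext <| LinearMap.ext fun w =>
    DFunLike.congr_fun (congrArg ModuleCat.Hom.hom (μ_natural_right F Z f)) (v ⊗ₜ[k] w)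

variable {F}

/-- The condition is checked one variable at a time. In the last variable `v ⊗ (-)` is natural and
carries the condition over from `w`; in each of the others `(-) ⊗ w` is natural and carries it over
from `v`. -/
theorem mu_mem_primPart {n : ℕ} {v : F.obj ⟨n⟩} (hv : v ∈ primPart F n) {w : F.obj ⟨1⟩}
    (hw : w ∈ reducedPolyPartOne F ⟨1⟩) : (μ F ⟨n⟩ ⟨1⟩).hom (v ⊗ₜ[k] w) ∈ primPart F (n + 1) := by
  rw [mem_primPart] at hv ⊢
  intro a b h
  cases b with
  | zero =>
    obtain rfl : a = n := by omega
    have h' := app_mem_reducedPolyPartOne (mulLeft F v ≫ Functor.whiskerRight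
      (Functor.whiskerLeft (tensorLeft (⟨a⟩ : GrOp)) (rightUnitorNatIso GrOp).inv) F) hw
    refine (congrArg (· ∈ reducedPolyPartOne (shift F a 0) ⟨1⟩) ?_).mp h'
    change act F (ρ_ ((⟨a⟩ : GrOp) ⊗ ⟨1⟩)).inv ((μ F ⟨a⟩ ⟨1⟩).hom (v ⊗ₜ[k] w)) = _
    rw [GrOp.rightUnitor_inv_eq_eqToHom _ rfl]
  | succ b =>
    obtain rfl : a + 1 + b = n := by omega
    have h' := app_mem_reducedPolyPartOne (Functor.whiskerLeft (tensorLeft (⟨a⟩ : GrOp))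
      (Functor.whiskerLeft (tensorRight (⟨b⟩ : GrOp)) (mulRight F w) ≫
        Functor.whiskerRight (tensorRightTensor (⟨b⟩ : GrOp) (⟨1⟩ : GrOp)).inv F)) (hv a b rfl)
    refine (congrArg (· ∈ reducedPolyPartOne (shift F a (b + 1)) ⟨1⟩) ?_).mp h'
    change act F (α_ ((⟨a⟩ : GrOp) ⊗ ⟨1⟩) ⟨b⟩ ⟨1⟩).hom
      ((μ F ⟨a + 1 + b⟩ ⟨1⟩).hom (act F (𝟙 _) v ⊗ₜ[k] w)) = _
    rw [act_id, GrOp.associator_hom_eq_eqToHom]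

end monoidal

/-- Used with `τ` a contraction of the last tensor factor. The variable at position `a` of `n` is
the variable at position `a` of `n + 1`, with `b + 1` instead of `b` variables to its right. -/
theorem mem_primPart_of_natTrans_shift {F : GrOp ⥤ ModuleCat.{u} k}
    (τ : tensorRight (⟨1⟩ : GrOp) ⋙ F ⟶ F) {n : ℕ} {v : F.obj ⟨n + 1⟩}
    (hv : v ∈ primPart F (n + 1)) : (τ.app ⟨n⟩).hom v ∈ primPart F n := by
  rw [mem_primPart] at hv ⊢
  rintro a b rfl
  have h' := app_mem_reducedPolyPartOne (Functor.whiskerLeft (tensorLeft (⟨a⟩ : GrOp))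
    (Functor.whiskerRight (tensorRightTensor (⟨b⟩ : GrOp) (⟨1⟩ : GrOp)).hom F ≫
      Functor.whiskerLeft (tensorRight (⟨b⟩ : GrOp)) τ)) (hv a (b + 1) rfl)
  refine (congrArg (· ∈ reducedPolyPartOne (shift F a b) ⟨1⟩) ?_).mp h'
  change (τ.app _).hom (act F (α_ ((⟨a⟩ : GrOp) ⊗ ⟨1⟩) ⟨b⟩ ⟨1⟩).inv (act F (eqToHom _) v)) =
    act F (𝟙 _) _
  rw [act_id, ← act_comp]
  have h : eqToHom (shift_eq (rfl : a + 1 + (b + 1) = a + 1 + b + 1)) ≫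
      (α_ ((⟨a⟩ : GrOp) ⊗ ⟨1⟩) ⟨b⟩ ⟨1⟩).inv = 𝟙 _ := by
    rw [Iso.comp_inv_eq, GrOp.associator_hom_eq_eqToHom]
    exact (Category.id_comp _).symm
  exact congrArg (τ.app _).hom ((congrArg (fun f => act F f v) h).trans (act_id v))

end GrModule

/-! ### Primitive elements as the degree one primitive part of `α(H)` -/

namespace CocommHopf

open GrModule GrpPower Functor.LaxMonoidal

variable {k : Type u} [CommRing k] {H : CocommHopf k}

theorem act_whiskerRight {n m : ℕ} (f : (⟨n⟩ : GrOp) ⟶ ⟨m⟩) (v : H.tensorPowers.obj ⟨n⟩)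
    (x : H.obj) : act H.tensorPowers (f ▷ (⟨1⟩ : GrOp)) (H.tmulLast n v x) =
      H.tmulLast m (act H.tensorPowers f v) x := by
  rw [← mu_tmul, ← mu_tmul]
  exact (DFunLike.congr_fun (congrArg ModuleCat.Hom.hom
    (μ_natural_left H.tensorPowers f (⟨1⟩ : GrOp))) (v ⊗ₜ[k] H.oneEquiv x)).symm

theorem act_whiskerLeft {n : ℕ} (f : (⟨1⟩ : GrOp) ⟶ ⟨1⟩) (v : H.tensorPowers.obj ⟨n⟩)
    {x y : H.obj} (h : act H.tensorPowers f (H.oneEquiv x) = H.oneEquiv y) :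
    act H.tensorPowers ((⟨n⟩ : GrOp) ◁ f) (H.tmulLast n v x) = H.tmulLast n v y := by
  rw [← mu_tmul, ← mu_tmul, ← h]
  exact (DFunLike.congr_fun (congrArg ModuleCat.Hom.hom
    (μ_natural_right H.tensorPowers (⟨n⟩ : GrOp) f)) (v ⊗ₜ[k] H.oneEquiv x)).symm

theorem act_zero_one_one (x : H.obj) :
    act H.tensorPowers (GrOp.zero ⟨1⟩ ⟨1⟩) (H.oneEquiv x) =
      H.oneEquiv (Coalgebra.counit (R := k) x • 1) := by
  have h : GrOp.zero ⟨1⟩ ⟨1⟩ = GrOp.zero ⟨1⟩ ⟨0⟩ ≫ GrOp.zero ⟨0⟩ ⟨1⟩ := by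
    ext i
    simp
  rw [h, act_comp, act_zero_one_zero, map_smul, act_zero_zero_one, map_smul]

variable (H) in
/-- The projection `x ↦ x - ε(x) 1` onto the augmentation ideal. -/
noncomputable def augProj : H.obj →ₗ[k] H.obj :=
  LinearMap.id - Algebra.linearMap k H.obj ∘ₗ Coalgebra.counit

theorem augProj_apply (x : H.obj) : H.augProj x = x - Coalgebra.counit (R := k) x • 1 := by
  simp [augProj, Algebra.algebraMap_eq_smul_one]

/-- The zero morphism acts on `H` as `x ↦ ε(x) 1`, so each factor of `χ` projects one tensor factor
onto the augmentation ideal. -/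
theorem chiTwo_tmulLast (a b : H.obj) :
    chiTwo H.tensorPowers ⟨1⟩ (H.tmulLast 1 (H.oneEquiv a) b) =
      H.tmulLast 1 (H.oneEquiv (H.augProj a)) (H.augProj b) := by
  let A : H.tensorPowers.obj ⟨2⟩ →ₗ[k] H.tensorPowers.obj ⟨2⟩ :=
    act H.tensorPowers (𝟙 (⟨1⟩ : GrOp) ⊗ₘ GrOp.zero ⟨1⟩ ⟨1⟩)
  let B : H.tensorPowers.obj ⟨2⟩ →ₗ[k] H.tensorPowers.obj ⟨2⟩ :=
    act H.tensorPowers (GrOp.zero ⟨1⟩ ⟨1⟩ ⊗ₘ 𝟙 (⟨1⟩ : GrOp))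
  have hA : A (H.tmulLast 1 (H.oneEquiv a) b) =
      H.tmulLast 1 (H.oneEquiv a) (Coalgebra.counit (R := k) b • 1) :=
    (congrArg (fun f => act H.tensorPowers f _) (id_tensorHom _ _)).trans
      (act_whiskerLeft _ _ (act_zero_one_one b))
  have hB (c : H.obj) : B (H.tmulLast 1 (H.oneEquiv a) c) =
      H.tmulLast 1 (H.oneEquiv (Coalgebra.counit (R := k) a • 1)) c :=
    (congrArg (fun f => act H.tensorPowers f _) (tensorHom_id _ _)).trans
      ((act_whiskerRight _ _ c).trans (by rw [act_zero_one_one]))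
  change H.tmulLast 1 (H.oneEquiv a) b - A (H.tmulLast 1 (H.oneEquiv a) b) -
    B (H.tmulLast 1 (H.oneEquiv a) b - A (H.tmulLast 1 (H.oneEquiv a) b)) = _
  rw [hA, ← map_sub, ← augProj_apply, hB, ← LinearMap.sub_apply, ← map_sub, ← map_sub,
    ← augProj_apply]

/-- Expand `(id - ηε) ⊗ (id - ηε)`, with `η` the unit map, and apply the counit axioms. For `ε(x) =
0` the right-hand side is the reduced coproduct, whose vanishing is primitivity of `x`. -/
theorem map_augProj_comul (x : H.obj) :
    TensorProduct.map H.augProj H.augProj (Coalgebra.comul (R := k) x) =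
      Coalgebra.comul (R := k) x - x ⊗ₜ[k] 1 - 1 ⊗ₜ[k] x +
        Coalgebra.counit (R := k) x • (1 : H.obj) ⊗ₜ[k] (1 : H.obj) := by
  have hr : LinearMap.lTensor H.obj (Algebra.linearMap k H.obj ∘ₗ Coalgebra.counit)
      (Coalgebra.comul (R := k) x) = x ⊗ₜ[k] 1 := by
    rw [LinearMap.lTensor_comp, LinearMap.comp_apply, Coalgebra.lTensor_counit_comul]
    simp
  have hl : LinearMap.rTensor H.obj (Algebra.linearMap k H.obj ∘ₗ Coalgebra.counit)
      (Coalgebra.comul (R := k) x) = 1 ⊗ₜ[k] x := by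
    rw [LinearMap.rTensor_comp, LinearMap.comp_apply, Coalgebra.rTensor_counit_comul]
    simp
  rw [← LinearMap.rTensor_comp_lTensor, LinearMap.comp_apply]
  have h₁ : LinearMap.lTensor H.obj H.augProj (Coalgebra.comul (R := k) x) =
      Coalgebra.comul (R := k) x - x ⊗ₜ[k] 1 := by
    rw [augProj, LinearMap.lTensor_sub, LinearMap.sub_apply, LinearMap.lTensor_id, hr]
    rfl
  rw [h₁, augProj, LinearMap.rTensor_sub, LinearMap.sub_apply, LinearMap.rTensor_id,
    map_sub (LinearMap.rTensor _ _), hl]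
  simp [Algebra.algebraMap_eq_smul_one]
  abel

/-- The dictionary between modules and Hopf algebras: belonging to `cr^1` means `ε(x) = 0`, and
belonging to `P_1` means that `χ ∘ Δ`, computed by `chiTwo_tmulLast`, kills `x`. -/
theorem oneEquiv_mem_reducedPolyPartOne {x : H.obj} :
    H.oneEquiv x ∈ reducedPolyPartOne H.tensorPowers ⟨1⟩ ↔ x ∈ HopfPrim.primElements k H.obj := by
  have h₁ : H.oneEquiv x ∈ crossEffectOne H.tensorPowers ⟨1⟩ ↔
      Coalgebra.counit (R := k) x = 0 := by
    constructor
    · rintro ⟨y, hy⟩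
      obtain ⟨y, rfl⟩ := H.oneEquiv.surjective y
      rw [LinearMap.sub_apply, act_zero_one_one, LinearMap.id_apply, ← map_sub] at hy
      rw [← H.oneEquiv.injective hy]
      simp
    · intro h
      refine ⟨H.oneEquiv x, ?_⟩
      rw [LinearMap.sub_apply, act_zero_one_one, h]
      simp
  have h₂ : H.oneEquiv x ∈ polyPartOne H.tensorPowers ⟨1⟩ ↔
      TensorProduct.map H.augProj H.augProj (Coalgebra.comul (R := k) x) = 0 := by
    have h : chiTwo H.tensorPowers ⟨1⟩ (act H.tensorPowers (lift (𝟙 _) (𝟙 _)) (H.oneEquiv x)) =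
        TensorProduct.lift (H.tmulLast 1 ∘ₗ H.oneEquiv.toLinearMap)
          (TensorProduct.map H.augProj H.augProj (Coalgebra.comul (R := k) x)) := by
      rw [act_diag]
      induction Coalgebra.comul (R := k) x using TensorProduct.induction_on with
      | zero => simp
      | add a b ha hb => simp only [map_add, ha, hb]
      | tmul a b => exact chiTwo_tmulLast a b
    change chiTwo H.tensorPowers ⟨1⟩ (act H.tensorPowers (lift (𝟙 _) (𝟙 _)) (H.oneEquiv x)) = 0 ↔ _
    rw [h, map_eq_zero_iff _ lift_tmulLast_injective]
  rw [reducedPolyPartOne, Submodule.mem_inf, h₁, h₂]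
  refine and_congr_right fun h => ?_
  rw [map_augProj_comul, h, zero_smul, add_zero, sub_sub, sub_eq_zero]

theorem tmulLast_mem_primPart {n : ℕ} {v : H.tensorPowers.obj ⟨n⟩}
    (hv : v ∈ primPart H.tensorPowers n) {x : H.obj} (hx : x ∈ HopfPrim.primElements k H.obj) :
    H.tmulLast n v x ∈ primPart H.tensorPowers (n + 1) := by
  rw [← mu_tmul]
  exact mu_mem_primPart hv (oneEquiv_mem_reducedPolyPartOne.mpr hx)

end CocommHopf

/-! ### Tuples of words extended by an empty word or by a new letter -/

namespace GrpPower

open scoped MonObj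

/-- The morphism `[x_1 | ⋯ | x_n | 1] : n ⟶ n + 1` of `gr^op`. -/
def oneLast (n : ℕ) : (⟨n⟩ : GrOp) ⟶ (⟨n + 1⟩ : GrOp) :=
  GrOp.tuple (X := ⟨n⟩) (Y := ⟨n + 1⟩) <| Fin.lastCases 1 fun i => FreeGroup.of i

theorem powMap_oneLast {C : Type*} [Category C] [CartesianMonoidalCategory C] (G : C) [GrpObj G]
    (n : ℕ) : powMap G (oneLast n) = (ρ_ (pow G n)).inv ≫ pow G n ◁ η[G] := by
  refine succ_ext (pow_ext n fun i => ?_) ?_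
  · have h := powMap_proj G (oneLast n) (Fin.castSucc i)
    rw [oneLast, GrOp.toHom_tuple_of, Fin.lastCases_castSucc, proj_castSucc] at h
    refine (Category.assoc _ _ _).trans (h.trans (FreeGroup.lift_apply_of.trans ?_))
    have h' : ((ρ_ (pow G n)).inv ≫ pow G n ◁ η[G]) ≫ fst (pow G n) G = 𝟙 (pow G n) := by simp
    exact ((h' =≫ proj G n i).trans (Category.id_comp _)).symm
  · have h := powMap_proj G (oneLast n) (Fin.last n)
    rw [oneLast, GrOp.toHom_tuple_of, Fin.lastCases_last, proj_last, map_one] at h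
    have h' : ((ρ_ (pow G n)).inv ≫ pow G n ◁ η[G]) ≫ snd (pow G n) G = 1 := by
      rw [Category.assoc, whiskerLeft_snd, rightUnitor_inv_snd_assoc]
      rfl
    exact h.trans h'.symm

end GrpPower

namespace GrModule.AssTuple

open GrpPower

variable {n m : ℕ}

/-- The tuple `(w_1, …, w_m, ∅)`. -/
def snocNil (w : AssTuple n m) : AssTuple n (m + 1) :=
  ⟨Fin.snoc w.1 [], fun i => by simp [Fin.sum_univ_castSucc, w.2 i]⟩

/-- The tuple `(w_1, …, w_m, w_{m+1} x_{n+1})`. -/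
def mulVar (w : AssTuple n (m + 1)) : AssTuple (n + 1) (m + 1) :=
  ⟨Fin.snoc (fun j => (w.1 j.castSucc).map Fin.castSucc)
    ((w.1 (Fin.last m)).map Fin.castSucc ++ [Fin.last n]), fun i => by
    rw [Fin.sum_univ_castSucc]
    simp only [Fin.snoc_castSucc, Fin.snoc_last, List.count_append]
    induction i using Fin.lastCases with
    | last =>
      have h (l : List (Fin n)) : (l.map Fin.castSucc).count (Fin.last n) = 0 :=
        List.count_eq_zero.mpr (by simp [Fin.castSucc_ne_last])
      simp [h]
    | cast i =>
      have h (l : List (Fin n)) : (l.map Fin.castSucc).count i.castSucc = l.count i :=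
        List.count_map_of_injective l _ (Fin.castSucc_injective n) i
      have h' := w.2 i
      rw [Fin.sum_univ_castSucc] at h'
      simpa [h, List.count_singleton, (Fin.castSucc_ne_last i).symm] using h'⟩

/-- The empty tuple of words in no variables. -/
def empty : AssTuple 0 0 := ⟨fun i => i.elim0, fun i => i.elim0⟩

theorem toGrOp_empty : empty.toGrOp = 𝟙 _ := GrOp.hom_ext fun i => i.elim0

theorem toHom_toGrOp (w : AssTuple n m) (j : Fin m) :
    GrOp.toHom w.toGrOp (FreeGroup.of j) = ((w.1 j).map FreeGroup.of).prod :=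
  GrOp.toHom_tuple_of (X := ⟨n⟩) (Y := ⟨m⟩) _ j

theorem toGrOp_snocNil (w : AssTuple n m) : w.snocNil.toGrOp = w.toGrOp ≫ oneLast m := by
  refine GrOp.hom_ext fun (j : Fin (m + 1)) => ?_
  rw [toHom_toGrOp, GrOp.toHom_comp, MonoidHom.comp_apply, oneLast, GrOp.toHom_tuple_of]
  induction j using Fin.lastCases with
  | last => simp [snocNil]
  | cast j =>
    rw [Fin.lastCases_castSucc, toHom_toGrOp]
    simp [snocNil]

theorem toHom_whiskerRight_castSucc (f : (⟨n⟩ : GrOp) ⟶ ⟨m⟩) (j : Fin m) :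
    GrOp.toHom (f ▷ (⟨1⟩ : GrOp)) (FreeGroup.of (Fin.castSucc j)) =
      FreeGroup.map Fin.castSucc (GrOp.toHom f (FreeGroup.of j)) := by
  have h := DFunLike.congr_fun (congrArg GrOp.toHom (whiskerRight_fst f (⟨1⟩ : GrOp)))
    (FreeGroup.of j)
  have h' : GrOp.toHom (fst (⟨n⟩ : GrOp) (⟨1⟩ : GrOp)) = FreeGroup.map (Fin.castSucc (n := n)) :=
    FreeGroup.ext_hom _ _ fun i => (GrOp.toHom_fst _ _ _).trans (FreeGroup.map.of).symm
  rw [GrOp.toHom_comp, GrOp.toHom_comp, MonoidHom.comp_apply, MonoidHom.comp_apply, h',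
    GrOp.toHom_fst] at h
  exact h

theorem toHom_whiskerRight_last (f : (⟨n⟩ : GrOp) ⟶ ⟨m⟩) :
    GrOp.toHom (f ▷ (⟨1⟩ : GrOp)) (FreeGroup.of (Fin.last m)) = FreeGroup.of (Fin.last n) := by
  have h := DFunLike.congr_fun (congrArg GrOp.toHom (whiskerRight_snd f (⟨1⟩ : GrOp)))
    (FreeGroup.of 0)
  rw [GrOp.toHom_comp, MonoidHom.comp_apply, GrOp.toHom_snd] at h
  exact h.trans (GrOp.toHom_snd _ _ _)

/-- Right multiplication of the last factor by a further primitive element is again given by a tuple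
of words using each variable once; this drives the induction on word length. -/
theorem toGrOp_mulVar (w : AssTuple n (m + 1)) :
    w.mulVar.toGrOp = w.toGrOp ▷ (⟨1⟩ : GrOp) ≫ mulLast m := by
  refine GrOp.hom_ext fun (j : Fin (m + 1)) => ?_
  have h (l : List (Fin n)) : FreeGroup.map Fin.castSucc (l.map FreeGroup.of).prod =
      ((l.map Fin.castSucc).map FreeGroup.of).prod := by
    rw [map_list_prod, List.map_map, List.map_map]
    rfl
  rw [toHom_toGrOp, GrOp.toHom_comp, MonoidHom.comp_apply, mulLast, GrOp.toHom_tuple_of]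
  induction j using Fin.lastCases with
  | last =>
    rw [Fin.lastCases_last]
    refine Eq.trans ?_ (map_mul _ _ _).symm
    refine Eq.trans ?_ (congrArg₂ (· * ·) (toHom_whiskerRight_castSucc w.toGrOp (Fin.last m))
      (toHom_whiskerRight_last w.toGrOp)).symm
    rw [toHom_toGrOp, h]
    simp [mulVar]
  | cast j =>
    rw [Fin.lastCases_castSucc]
    refine Eq.trans ?_ (toHom_whiskerRight_castSucc w.toGrOp j.castSucc).symm
    rw [toHom_toGrOp, h]
    simp [mulVar]

end GrModule.AssTuple

/-! ### Primitive Hopf algebras give primitive modules -/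

namespace CocommHopf

open GrModule GrpPower

variable {k : Type u} [CommRing k] {H : CocommHopf k}

theorem act_oneLast (n : ℕ) (v : H.tensorPowers.obj ⟨n⟩) :
    act H.tensorPowers (oneLast n) v = H.tmulLast n v 1 :=
  (DFunLike.congr_fun (congrArg (fun f => f.toCoalgHom.toLinearMap)
    (powMap_oneLast H.grp n)) v).trans
    (congrArg (H.tmulLast n v) (map_one (algebraMap k H.obj)))

variable (H) in
/-- The union of the primitive filtration of `H^{⊗ m}`. -/
noncomputable def filtrationUnion (m : ℕ) : Submodule k (H.tensorPowers.obj ⟨m⟩) :=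
  ⨆ (n : ℕ) (w : AssTuple n m), (primPart H.tensorPowers n).map (act H.tensorPowers w.toGrOp)

theorem act_mem_filtrationUnion {n m : ℕ} (w : AssTuple n m) {v : H.tensorPowers.obj ⟨n⟩}
    (hv : v ∈ primPart H.tensorPowers n) : act H.tensorPowers w.toGrOp v ∈ H.filtrationUnion m :=
  Submodule.mem_iSup_of_mem n (Submodule.mem_iSup_of_mem w ⟨v, hv, rfl⟩)

theorem unitElt_mem_filtrationUnion : H.unitElt ∈ H.filtrationUnion 0 := by
  have h : H.unitElt ∈ primPart H.tensorPowers 0 :=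
    -- No decomposition `a + 1 + b = 0` exists, so the primitive part in degree `0` is all of `H^{⊗
    -- 0}`.
    mem_primPart.mpr fun a b h => absurd h (by omega)
  have h' := act_mem_filtrationUnion AssTuple.empty h
  rwa [AssTuple.toGrOp_empty, act_id] at h'

theorem tmulLast_one_mem_filtrationUnion {m : ℕ} {v : H.tensorPowers.obj ⟨m⟩}
    (hv : v ∈ H.filtrationUnion m) : H.tmulLast m v 1 ∈ H.filtrationUnion (m + 1) := by
  have hle : H.filtrationUnion m ≤
      (H.filtrationUnion (m + 1)).comap ((H.tmulLast m).flip 1) := by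
    refine iSup_le fun n => iSup_le fun w => ?_
    rintro _ ⟨x, hx, rfl⟩
    rw [Submodule.mem_comap, LinearMap.flip_apply, ← act_oneLast, ← act_comp,
      ← AssTuple.toGrOp_snocNil]
    exact act_mem_filtrationUnion _ hx
  exact hle hv

/-- If `v` is the action of `w` on a primitive `x` of degree `n`, then `x ⊗ p` is primitive of
degree `n + 1`, and `w.mulVar` sends it to the required element. -/
theorem mulLast_mem_filtrationUnion {m : ℕ} {v : H.tensorPowers.obj ⟨m + 1⟩}
    (hv : v ∈ H.filtrationUnion (m + 1)) {p : H.obj} (hp : p ∈ HopfPrim.primElements k H.obj) :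
    act H.tensorPowers (mulLast m) (H.tmulLast (m + 1) v p) ∈ H.filtrationUnion (m + 1) := by
  have hle : H.filtrationUnion (m + 1) ≤ (H.filtrationUnion (m + 1)).comap
      (act H.tensorPowers (mulLast m) ∘ₗ (H.tmulLast (m + 1)).flip p) := by
    refine iSup_le fun n => iSup_le fun w => ?_
    rintro _ ⟨x, hx, rfl⟩
    have h := act_mem_filtrationUnion w.mulVar (tmulLast_mem_primPart hx hp)
    rw [AssTuple.toGrOp_mulVar, act_comp] at h
    have h' := act_whiskerRight w.toGrOp x p
    exact (congrArg (fun y => act H.tensorPowers (mulLast m) y ∈ H.filtrationUnion (m + 1)) h').mp h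
  exact hle hv

theorem filtrationUnion_eq_top (hH : HopfPrim.IsPrimitive k H.obj) (m : ℕ) :
    H.filtrationUnion m = ⊤ := by
  induction m with
  | zero =>
    rw [eq_top_iff]
    rintro (c : k) -
    have h := (H.filtrationUnion 0).smul_mem c unitElt_mem_filtrationUnion
    have h' : c • H.unitElt = (c : k) := mul_one c
    rwa [h'] at h
  | succ m ih =>
    -- `V` contains `1` by induction on `m` and is stable under right multiplication by `P_1(H)`. It
    -- therefore contains every power of `P_1(H)`, and these exhaust `H`.
    let V : Submodule k H.obj :=
      ⨅ v : H.tensorPowers.obj ⟨m⟩, (H.filtrationUnion (m + 1)).comap (H.tmulLast m v)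
    have hV (x : H.obj) : x ∈ V ↔ ∀ v, H.tmulLast m v x ∈ H.filtrationUnion (m + 1) := by
      simp [V, Submodule.mem_iInf]
    have hmul : ∀ x ∈ V, ∀ q ∈ HopfPrim.primOne k H.obj, x * q ∈ V := by
      intro x hx q hq
      obtain ⟨c, hc, p, hp, rfl⟩ := Submodule.mem_sup.mp hq
      obtain ⟨c, rfl⟩ := Submodule.mem_span_singleton.mp hc
      rw [mul_add, mul_smul_comm, mul_one]
      refine V.add_mem (V.smul_mem c hx) ((hV _).mpr fun v => ?_)
      rw [← act_mulLast]
      exact mulLast_mem_filtrationUnion ((hV x).mp hx v) hp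
    have hpow (n : ℕ) : HopfPrim.primOne k H.obj ^ n ≤ V := by
      induction n with
      | zero =>
        rw [pow_zero, Submodule.one_le, hV]
        exact fun v => tmulLast_one_mem_filtrationUnion (ih ▸ Submodule.mem_top)
      | succ n ihn =>
        rw [pow_succ, Submodule.mul_le]
        exact fun x hx q hq => hmul x (ihn hx) q hq
    have htop : V = ⊤ := eq_top_iff.mpr (hH ▸ iSup_le hpow)
    rw [eq_top_iff]
    rintro t -
    refine TensorProduct.induction_on (motive := fun t => t ∈ H.filtrationUnion (m + 1)) t
      (zero_mem _) (fun v x => ?_) (fun _ _ => add_mem)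
    exact (hV x).mp (htop ▸ Submodule.mem_top) v

theorem isPrimitive_tensorPowers (hH : HopfPrim.IsPrimitive k H.obj) :
    GrModule.IsPrimitive H.tensorPowers := fun m => by
  rw [iSup_primFiltration]
  exact filtrationUnion_eq_top hH m

end CocommHopf

/-! ### The Hopf algebra structure of the tensor algebra -/

namespace TensorAlgebra

variable (k : Type*) [CommRing k] (M : Type*) [AddCommMonoid M] [Module k M]

/-- The bialgebra structure on the tensor algebra for which the generators are primitive. -/
noncomputable instance instBialgebra : Bialgebra k (TensorAlgebra k M) :=
  .ofAlgHom
    (lift k ((TensorProduct.mk k _ _).flip 1 ∘ₗ ι k + TensorProduct.mk k _ _ 1 ∘ₗ ι k))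
    algebraMapInv
    (by
      ext x
      simp [Algebra.TensorProduct.one_def, TensorProduct.add_tmul, TensorProduct.tmul_add]
      abel)
    (by ext x; simp [algebraMapInv])
    (by ext x; simp [algebraMapInv])

variable {k M}

theorem comul_ι (x : M) :
    Coalgebra.comul (R := k) (ι k x) = ι k x ⊗ₜ[k] 1 + 1 ⊗ₜ[k] ι k x :=
  lift_ι_apply _ x

theorem counit_ι (x : M) : Coalgebra.counit (R := k) (ι k x) = 0 := by
  change algebraMapInv (ι k x) = 0
  simp [algebraMapInv]

variable (k M) in
/-- The antipode, the anti-automorphism that changes the sign of the generators. -/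
noncomputable def antipodeMap : TensorAlgebra k M →ₗ[k] TensorAlgebra k M :=
  (MulOpposite.opLinearEquiv k).symm.toLinearMap ∘ₗ
    (lift k (-((MulOpposite.opLinearEquiv k).toLinearMap ∘ₗ ι k (M := M)))).toLinearMap

theorem antipodeMap_one : antipodeMap k M 1 = 1 := by simp [antipodeMap]

theorem antipodeMap_mul (x y : TensorAlgebra k M) :
    antipodeMap k M (x * y) = antipodeMap k M y * antipodeMap k M x := by simp [antipodeMap]

theorem antipodeMap_ι (x : M) : antipodeMap k M (ι k x) = -ι k x := by simp [antipodeMap]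

-- Prepending one letter at a time suits the antipode axioms, because left multiplication by a
-- generator has a simple effect on the coproduct.
@[elab_as_elim]
theorem left_induction {p : TensorAlgebra k M → Prop} (x : TensorAlgebra k M) (one : p 1)
    (smul : ∀ (c : k) y, p y → p (c • y)) (add : ∀ y z, p y → p z → p (y + z))
    (ι_mul : ∀ v y, p y → p (ι k v * y)) : p x := by
  suffices h : ∀ y, p y → p (x * y) by simpa using h 1 one
  induction x using TensorAlgebra.induction with
  | algebraMap r =>
    intro y hy
    rw [← Algebra.smul_def]
    exact smul r y hy
  | ι v => exact ι_mul v
  | mul a b ha hb =>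
    intro y hy
    rw [mul_assoc]
    exact ha _ (hb y hy)
  | add a b ha hb =>
    intro y hy
    rw [add_mul]
    exact add _ _ (ha y hy) (hb y hy)

noncomputable instance instHopfAlgebra : HopfAlgebra k (TensorAlgebra k M) where
  antipode := antipodeMap k M
  mul_antipode_rTensor_comul := by
    refine LinearMap.ext fun x => ?_
    induction x using left_induction with
    | one =>
      simp [Algebra.TensorProduct.one_def, antipodeMap_one]
    | smul c y hy => rw [map_smul, map_smul, hy]
    | add y z hy hz => rw [map_add, map_add, hy, hz]
    | ι_mul v y hy =>
      -- On `a ⊗ b` the two terms are `S(v a) b = -S(a) v b` and `S(a) v b`, which cancel. No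
      -- induction hypothesis is needed on this side.
      have h : ∀ t : TensorAlgebra k M ⊗[k] TensorAlgebra k M,
          LinearMap.mul' k _ ((antipodeMap k M).rTensor _
            ((ι k v ⊗ₜ[k] 1 + 1 ⊗ₜ[k] ι k v) * t)) = 0 := by
        intro t
        induction t using TensorProduct.induction_on with
        | zero => simp
        | add a b ha hb => rw [mul_add, map_add, map_add, ha, hb, add_zero]
        | tmul a b => simp [add_mul, antipodeMap_mul, antipodeMap_ι, mul_assoc]
      simp only [LinearMap.comp_apply, Bialgebra.comul_mul, comul_ι, h, Bialgebra.counit_mul,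
        counit_ι, zero_mul, map_zero]
  mul_antipode_lTensor_comul := by
    refine LinearMap.ext fun x => ?_
    induction x using left_induction with
    | one =>
      simp [Algebra.TensorProduct.one_def, antipodeMap_one]
    | smul c y hy => rw [map_smul, map_smul, hy]
    | add y z hy hz => rw [map_add, map_add, hy, hz]
    | ι_mul v y hy =>
      -- Here `v a S(b)` and `a S(v b) = -a S(b) v` combine to a commutator with `v`. It vanishes
      -- for `t = Δ(y)`, since the induction hypothesis then turns the other entry into a scalar.
      have h : ∀ t : TensorAlgebra k M ⊗[k] TensorAlgebra k M,
          LinearMap.mul' k _ ((antipodeMap k M).lTensor _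
            ((ι k v ⊗ₜ[k] 1 + 1 ⊗ₜ[k] ι k v) * t)) =
          ι k v * LinearMap.mul' k _ ((antipodeMap k M).lTensor _ t) -
            LinearMap.mul' k _ ((antipodeMap k M).lTensor _ t) * ι k v := by
        intro t
        induction t using TensorProduct.induction_on with
        | zero => simp
        | add a b ha hb =>
          simp only [mul_add, map_add, add_mul] at ha hb ⊢
          rw [ha, hb]
          abel
        | tmul a b => simp [add_mul, antipodeMap_mul, antipodeMap_ι, mul_assoc, sub_eq_add_neg]
      have hy' : LinearMap.mul' k _ ((antipodeMap k M).lTensor _ (Coalgebra.comul (R := k) y)) =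
          algebraMap k _ (Coalgebra.counit (R := k) y) := hy
      simp only [LinearMap.comp_apply, Bialgebra.comul_mul, comul_ι, h, Bialgebra.counit_mul,
        counit_ι, zero_mul, map_zero, hy']
      rw [Algebra.commutes, sub_self]

instance instIsCocomm : Coalgebra.IsCocomm k (TensorAlgebra k M) where
  comm_comp_comul := by
    have h : (Algebra.TensorProduct.comm k (TensorAlgebra k M)
          (TensorAlgebra k M)).toAlgHom.comp (Bialgebra.comulAlgHom k _) =
        Bialgebra.comulAlgHom k (TensorAlgebra k M) := by
      ext x
      simp [comul_ι]
      abel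
    exact congr(($h).toLinearMap)

end TensorAlgebra

/-! ### Primitive parts under flat tensor products -/

theorem IsField.moduleFree {k : Type*} [CommRing k] (hk : IsField k) (M : Type*) [AddCommGroup M]
    [Module k M] : Module.Free k M :=
  letI := hk.toField
  Module.Free.of_divisionRing k M

theorem IsField.exists_retraction {k : Type*} [CommRing k] (hk : IsField k) {M : Type*}
    [AddCommGroup M] [Module k M] (N : Submodule k M) :
    ∃ r : M →ₗ[k] N, r ∘ₗ N.subtype = LinearMap.id :=
  letI := hk.toField
  LinearMap.exists_leftInverse_of_injective N.subtype (Submodule.ker_subtype N)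

namespace GrModule

variable {k : Type u} [CommRing k] {F : GrOp ⥤ ModuleCat.{u} k}

/-- `F(p)` is idempotent because `p` is, so the image of `id - F(p)` is the kernel of `F(p)`. -/
theorem mem_crossEffectOne {X : GrOp} {v : F.obj X} :
    v ∈ crossEffectOne F X ↔ act F (GrOp.zero X X) v = 0 := by
  constructor
  · rintro ⟨w, rfl⟩
    have h : GrOp.zero X X ≫ GrOp.zero X X = GrOp.zero X X := by
      ext i
      simp
    rw [LinearMap.sub_apply, LinearMap.id_apply, map_sub, ← act_comp, h, sub_self]
  · intro h
    exact ⟨v, by rw [LinearMap.sub_apply, LinearMap.id_apply, h, sub_zero]⟩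

theorem chiTwo_comp_tensorLeft (M : ModuleCat.{u} k) (X : GrOp) :
    chiTwo (F ⋙ tensorLeft M) X = LinearMap.lTensor M (chiTwo F X) := by
  rw [chiTwo, chiTwo, LinearMap.lTensor_comp, LinearMap.lTensor_sub, LinearMap.lTensor_sub,
    LinearMap.lTensor_id]
  rfl

/-- Presents `P_1(cr^1(F))(X)` as the kernel of one linear map, a form to which flatness applies. -/
theorem exact_reducedPolyPartOne (F : GrOp ⥤ ModuleCat.{u} k) (X : GrOp) :
    Function.Exact (reducedPolyPartOne F X).subtype
      ((chiTwo F X ∘ₗ act F (lift (𝟙 X) (𝟙 X))).prod (act F (GrOp.zero X X))) := by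
  rw [LinearMap.exact_iff, Submodule.range_subtype, LinearMap.ker_prod]
  ext v
  rw [reducedPolyPartOne, Submodule.mem_inf, Submodule.mem_inf, mem_crossEffectOne, and_comm]
  rfl

theorem reducedPolyPartOne_comp_tensorLeft_le (M : ModuleCat.{u} k) [Module.Flat k M]
    (X : GrOp) : reducedPolyPartOne (F ⋙ tensorLeft M) X ≤
      LinearMap.range (LinearMap.lTensor M (reducedPolyPartOne F X).subtype) := by
  rintro v ⟨h₁, h₂⟩
  refine (Module.Flat.lTensor_exact M (exact_reducedPolyPartOne F X) v).mp ?_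
  have h₂' : LinearMap.lTensor M (chiTwo F X ∘ₗ act F (lift (𝟙 X) (𝟙 X))) v = 0 := by
    rw [LinearMap.lTensor_comp, ← chiTwo_comp_tensorLeft]
    exact h₂
  have h₁' : LinearMap.lTensor M (act F (GrOp.zero X X)) v = 0 :=
    mem_crossEffectOne.mp h₁
  have h (T : F.obj X →ₗ[k] F.obj (X ⊗ X)) (P : F.obj X →ₗ[k] F.obj X)
      (hT : LinearMap.lTensor M T v = 0) (hP : LinearMap.lTensor M P v = 0) :
      LinearMap.lTensor M (T.prod P) v = 0 := by
    have e : T.prod P = LinearMap.inl k _ _ ∘ₗ T + LinearMap.inr k _ _ ∘ₗ P := by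
      ext <;> simp
    rw [e, LinearMap.lTensor_add, LinearMap.lTensor_comp, LinearMap.lTensor_comp,
      LinearMap.add_apply, LinearMap.comp_apply, LinearMap.comp_apply, hT, hP, map_zero, map_zero,
      add_zero]
  exact h _ _ h₂' h₁'

section

open Functor.OplaxMonoidal

/-- The natural transformation `F(n + X) → F(n) ⊗ F(X)` of an oplax monoidal functor. -/
noncomputable def splitFirst (F : GrOp ⥤ ModuleCat.{u} k) [F.OplaxMonoidal] (Z : GrOp) :
    tensorLeft Z ⋙ F ⟶ F ⋙ tensorLeft (F.obj Z) where
  app X := δ F Z X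
  naturality _ _ f := (δ_natural_right F Z f).symm

end

end GrModule

/-! ### Primitive modules come from primitive Hopf algebras over a field -/

namespace HopfPrim

variable (k H : Type u) [CommRing k] [Ring H] [HopfAlgebra k H]

/-- The homomorphism from the tensor algebra on the primitive elements of a Hopf algebra. -/
noncomputable def liftPrim : TensorAlgebra k (primElements k H) →ₐc[k] H :=
  BialgHom.ofAlgHom (TensorAlgebra.lift k (primElements k H).subtype)
    (by
      ext x
      simp [TensorAlgebra.counit_ι, x.2.1])
    (by
      ext x
      simp [TensorAlgebra.comul_ι, x.2.2])

variable {k H}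

theorem liftPrim_ι (x : primElements k H) : liftPrim k H (TensorAlgebra.ι k x) = x :=
  TensorAlgebra.lift_ι_apply _ x

theorem liftPrim_mem (t : TensorAlgebra k (primElements k H)) :
    liftPrim k H t ∈ ⨆ n : ℕ, primOne k H ^ n := by
  induction t using TensorAlgebra.induction with
  | algebraMap r =>
    refine Submodule.mem_iSup_of_mem 0 ?_
    rw [pow_zero, AlgHomClass.commutes (liftPrim k H)]
    exact Submodule.algebraMap_mem r
  | ι x =>
    refine Submodule.mem_iSup_of_mem 1 ?_
    rw [pow_one, liftPrim_ι]
    exact Submodule.mem_sup_right x.2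
  | mul a b ha hb =>
    have h := Submodule.mul_mem_mul ha hb
    rw [← map_mul, Submodule.iSup_mul] at h
    refine (iSup_le fun n => ?_ : _ ≤ ⨆ n : ℕ, primOne k H ^ n) h
    rw [Submodule.mul_iSup]
    refine iSup_le fun m => ?_
    rw [← pow_add]
    exact le_iSup (fun n => primOne k H ^ n) (n + m)
  | add a b ha hb =>
    rw [map_add]
    exact add_mem ha hb

end HopfPrim

namespace CocommHopf

open GrModule GrpPower Functor.LaxMonoidal Functor.OplaxMonoidal

variable {k : Type u} [CommRing k] {H : CocommHopf k}

variable (H) in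
/-- The map `v ⊗ x ↦ f(x) v` from `H^{⊗ (n + 1)}` to `H^{⊗ n}`. -/
noncomputable def contractLast (f : H.obj →ₗ[k] k) (n : ℕ) :
    H.tensorPowers.obj ⟨n + 1⟩ →ₗ[k] H.tensorPowers.obj ⟨n⟩ :=
  TensorProduct.lift (M := (pow H.grp n).carrier) (N := H.obj)
    ((LinearMap.lsmul k (pow H.grp n).carrier ∘ₗ f).flip)

theorem contractLast_tmulLast (f : H.obj →ₗ[k] k) (n : ℕ) (v : H.tensorPowers.obj ⟨n⟩)
    (x : H.obj) : H.contractLast f n (H.tmulLast n v x) = f x • v := rfl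

/-- The maps `contractLast` form a natural transformation. -/
noncomputable def contract (f : H.obj →ₗ[k] k) :
    tensorRight (⟨1⟩ : GrOp) ⋙ H.tensorPowers ⟶ H.tensorPowers where
  app X := ModuleCat.ofHom (H.contractLast f X.rank)
  naturality X Y g := by
    refine ModuleCat.hom_ext (hom_ext_succ fun v x => ?_)
    change H.contractLast f Y.rank (act H.tensorPowers (g ▷ (⟨1⟩ : GrOp)) (H.tmulLast _ v x)) =
      act H.tensorPowers g (H.contractLast f X.rank (H.tmulLast _ v x))
    rw [act_whiskerRight (n := X.rank) (m := Y.rank) g v x, contractLast_tmulLast,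
      contractLast_tmulLast, map_smul]

theorem contractLast_mem_primPart (f : H.obj →ₗ[k] k) {n : ℕ} {v : H.tensorPowers.obj ⟨n + 1⟩}
    (hv : v ∈ primPart H.tensorPowers (n + 1)) :
    H.contractLast f n v ∈ primPart H.tensorPowers n :=
  mem_primPart_of_natTrans_shift (contract f) hv

theorem delta_tmulLast (n : ℕ) (v : H.tensorPowers.obj ⟨n⟩) (x : H.obj) :
    (δ H.tensorPowers ⟨n⟩ ⟨1⟩).hom (H.tmulLast n v x) = v ⊗ₜ[k] H.oneEquiv x := by
  rw [← mu_tmul]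
  exact DFunLike.congr_fun (congrArg ModuleCat.Hom.hom
    (Functor.Monoidal.μ_δ H.tensorPowers ⟨n⟩ ⟨1⟩)) (v ⊗ₜ[k] H.oneEquiv x)

/-- Only the condition at the last variable is used. It places `v` in `P_1(cr^1)` of `H^{⊗ n} ⊗
α(H)(-)`, which by flatness comes from `H^{⊗ n} ⊗ Prim(H)`. -/
theorem mem_range_of_mem_primPart {n : ℕ} [Module.Flat k (H.tensorPowers.obj ⟨n⟩)]
    {v : H.tensorPowers.obj ⟨n + 1⟩} (hv : v ∈ primPart H.tensorPowers (n + 1)) :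
    v ∈ LinearMap.range (TensorProduct.lift
      ((H.tmulLast n).compl₂ (HopfPrim.primElements k H.obj).subtype)) := by
  have h := app_mem_reducedPolyPartOne
    (Functor.whiskerRight (Functor.whiskerLeft (tensorLeft (⟨n⟩ : GrOp))
      (rightUnitorNatIso GrOp).hom) H.tensorPowers ≫ splitFirst H.tensorPowers (⟨n⟩ : GrOp))
    (mem_primPart.mp hv n 0 rfl)
  have h' : δ H.tensorPowers ⟨n⟩ ⟨1⟩ v ∈
      reducedPolyPartOne (H.tensorPowers ⋙ tensorLeft (H.tensorPowers.obj ⟨n⟩)) ⟨1⟩ := by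
    refine (congrArg (· ∈ reducedPolyPartOne
      (H.tensorPowers ⋙ tensorLeft (H.tensorPowers.obj ⟨n⟩)) ⟨1⟩) ?_).mp h
    change (δ H.tensorPowers ⟨n⟩ ⟨1⟩).hom (act H.tensorPowers (ρ_ ((⟨n⟩ : GrOp) ⊗ ⟨1⟩)).hom
      (act H.tensorPowers (𝟙 _) v)) = _
    have hρ : (ρ_ ((⟨n⟩ : GrOp) ⊗ ⟨1⟩)).hom = 𝟙 ((⟨n⟩ : GrOp) ⊗ ⟨1⟩) := by
      rw [← cancel_epi (ρ_ ((⟨n⟩ : GrOp) ⊗ ⟨1⟩)).inv, Iso.inv_hom_id,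
        GrOp.rightUnitor_inv_eq_eqToHom _ rfl]
      rfl
    rw [act_id]
    exact congrArg (δ H.tensorPowers ⟨n⟩ ⟨1⟩).hom
      ((congrArg (fun f => act H.tensorPowers f v) hρ).trans (act_id v))
  obtain ⟨t, ht⟩ := reducedPolyPartOne_comp_tensorLeft_le _ _ h'
  have hinj : Function.Injective (δ H.tensorPowers ⟨n⟩ ⟨1⟩).hom :=
    (ModuleCat.mono_iff_injective _).mp inferInstance
  have key : ∀ t, ∃ s, δ H.tensorPowers ⟨n⟩ ⟨1⟩ (TensorProduct.lift ((H.tmulLast n).compl₂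
      (HopfPrim.primElements k H.obj).subtype) s) =
      LinearMap.lTensor (H.tensorPowers.obj ⟨n⟩)
        (reducedPolyPartOne H.tensorPowers ⟨1⟩).subtype t := by
    intro t
    induction t using TensorProduct.induction_on with
    | zero => exact ⟨0, by simp⟩
    | add a b ha hb =>
      obtain ⟨s, hs⟩ := ha
      obtain ⟨s', hs'⟩ := hb
      exact ⟨s + s', by rw [map_add, map_add, map_add, hs, hs']⟩
    | tmul a b =>
      obtain ⟨b, hb⟩ := b
      obtain ⟨x, rfl⟩ := H.oneEquiv.surjective b
      exact ⟨a ⊗ₜ[k] ⟨x, oneEquiv_mem_reducedPolyPartOne.mp hb⟩, delta_tmulLast n a x⟩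
  obtain ⟨s, hs⟩ := key t
  exact ⟨s, hinj (hs.trans ht)⟩

/-- Write `v = ∑ c_i ⊗ b_i` with `b` a basis of `Prim(H)`. Contracting the last factor is natural in
the remaining ones, so contraction with the functional dual to `b_i` shows that `c_i` is primitive
of degree `n`. -/
theorem primPart_succ_le (hk : IsField k) (n : ℕ) :
    primPart H.tensorPowers (n + 1) ≤ Submodule.map₂ (H.tmulLast n) (primPart H.tensorPowers n)
      (HopfPrim.primElements k H.obj) := by
  intro v hv
  have := hk.moduleFree (H.tensorPowers.obj ⟨n⟩)
  have := hk.moduleFree (HopfPrim.primElements k H.obj)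
  obtain ⟨t, rfl⟩ := mem_range_of_mem_primPart hv
  -- The retraction extends the coordinate functionals from `Prim(H)` to `H`.
  obtain ⟨r, hr⟩ := hk.exists_retraction (HopfPrim.primElements k H.obj)
  let b := Module.Free.chooseBasis k (HopfPrim.primElements k H.obj)
  obtain ⟨c, rfl⟩ := TensorProduct.eq_repr_basis_right b t
  have hc (i) : c i ∈ primPart H.tensorPowers n := by
    have h := contractLast_mem_primPart (b.coord i ∘ₗ r) hv
    rw [Finsupp.sum, map_sum, map_sum] at h
    have h' (j) : H.contractLast (b.coord i ∘ₗ r) n (TensorProduct.lift ((H.tmulLast n).compl₂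
        (HopfPrim.primElements k H.obj).subtype) (c j ⊗ₜ[k] b j)) =
        if j = i then c j else 0 := by
      have hrj : r (b j) = b j := DFunLike.congr_fun hr (b j)
      have e := contractLast_tmulLast (b.coord i ∘ₗ r) n (c j) (b j)
      rw [LinearMap.comp_apply, hrj, Module.Basis.coord_apply, Module.Basis.repr_self,
        Finsupp.single_apply, ite_smul, one_smul, zero_smul] at e
      exact e
    simp only [h'] at h
    rw [Finset.sum_ite_eq'] at h
    split_ifs at h with hi
    · exact h
    · rw [Finsupp.notMem_support_iff.mp hi]
      exact zero_mem _
  rw [Finsupp.sum, map_sum]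
  exact Submodule.sum_mem _ fun i _ => Submodule.apply_mem_map₂ _ (hc i) (b i).2

variable (H) in
/-- The tensor algebra on the primitive elements. -/
noncomputable def primTensorAlgebra : CocommHopf k where
  obj := HopfAlgCat.of k (TensorAlgebra k (HopfPrim.primElements k H.obj))
  property := TensorAlgebra.instIsCocomm

variable (H) in
/-- The homomorphism from the tensor algebra on the primitive elements. -/
noncomputable def fromPrimTensorAlgebra : H.primTensorAlgebra ⟶ H :=
  ObjectProperty.homMk (HopfAlgCat.ofHom (HopfPrim.liftPrim k H.obj))

/-- Iterating `primPart_succ_le` writes a primitive element as a sum of tensors of elements of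
`Prim(H)`, each of which is the image of a generator. -/
theorem primPart_le_range (hk : IsField k) (n : ℕ) : primPart H.tensorPowers n ≤
    LinearMap.range ((tensorPowersMap H.fromPrimTensorAlgebra).app ⟨n⟩).hom := by
  induction n with
  | zero => exact fun v _ => ⟨v, rfl⟩
  | succ n ih =>
    refine (primPart_succ_le hk n).trans (Submodule.map₂_le.mpr fun v hv x hx => ?_)
    obtain ⟨w, rfl⟩ := ih hv
    refine ⟨H.primTensorAlgebra.tmulLast n w (TensorAlgebra.ι k ⟨x, hx⟩), ?_⟩
    exact (tensorPowersMap_app_succ H.fromPrimTensorAlgebra n w _).trans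
      (congrArg _ (HopfPrim.liftPrim_ι ⟨x, hx⟩))

theorem isPrimitive_of_isPrimitive_tensorPowers (hk : IsField k)
    (h : GrModule.IsPrimitive H.tensorPowers) : HopfPrim.IsPrimitive k H.obj := by
  have hle : (⊤ : Submodule k (H.tensorPowers.obj ⟨1⟩)) ≤
      LinearMap.range ((tensorPowersMap H.fromPrimTensorAlgebra).app ⟨1⟩).hom := by
    rw [← h 1, iSup_primFiltration]
    refine iSup_le fun n => iSup_le fun w => ?_
    rintro _ ⟨v, hv, rfl⟩
    obtain ⟨t, rfl⟩ := primPart_le_range hk n hv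
    -- The image of a natural transformation is stable under the actions of words, so it absorbs
    -- every step of the filtration.
    exact ⟨_, naturality_apply (tensorPowersMap H.fromPrimTensorAlgebra) w.toGrOp t⟩
  rw [HopfPrim.IsPrimitive, eq_top_iff]
  rintro x -
  obtain ⟨t, ht⟩ := hle (Submodule.mem_top (x := H.oneEquiv x))
  obtain ⟨t, rfl⟩ := H.primTensorAlgebra.oneEquiv.surjective t
  rw [tensorPowersMap_app_one] at ht
  rw [← H.oneEquiv.injective ht]
  exact HopfPrim.liftPrim_mem t

end CocommHopf

/-! ### The group object `1` of `gr^op` and functors preserving products -/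

namespace GrOp

open scoped MonObj

/-- The presheaf of groups `n ↦ F_n` on `gr^op`. -/
def freePresheaf : GrOpᵒᵖ ⥤ GrpCat.{0} where
  obj X := GrpCat.of X.unop.free
  map f := GrpCat.ofHom (toHom f.unop)

/-- The object `1` represents the presheaf `n ↦ F_n`. -/
def freePresheafRepresentableBy :
    (freePresheaf ⋙ CategoryTheory.forget GrpCat).RepresentableBy (⟨1⟩ : GrOp) where
  homEquiv {X} :=
    { toFun f := toHom f (FreeGroup.of 0)
      invFun w := tuple (X := X) (Y := ⟨1⟩) fun _ => w
      left_inv f := hom_ext fun (i : Fin 1) => by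
        obtain rfl : i = 0 := Subsingleton.elim _ _
        exact toHom_tuple_of (X := X) (Y := ⟨1⟩) _ _
      right_inv w := toHom_tuple_of (X := X) (Y := ⟨1⟩) _ _ }
  homEquiv_comp f g := rfl

instance : GrpObj (⟨1⟩ : GrOp) := GrpObj.ofRepresentableBy _ freePresheaf freePresheafRepresentableBy

/-- A word in `F_n`, as a morphism `n ⟶ 1`. -/
def word {X : GrOp} (w : X.free) : X ⟶ (⟨1⟩ : GrOp) := tuple (X := X) (Y := ⟨1⟩) fun _ => w

theorem toHom_word {X : GrOp} (w : X.free) : toHom (word w) (FreeGroup.of 0) = w :=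
  toHom_tuple_of (X := X) (Y := ⟨1⟩) _ _

theorem hom_one_ext {X : GrOp} {f g : X ⟶ (⟨1⟩ : GrOp)}
    (h : toHom f (FreeGroup.of 0) = toHom g (FreeGroup.of 0)) : f = g :=
  hom_ext fun (i : Fin 1) => by
    obtain rfl : i = 0 := Subsingleton.elim _ _
    exact h

theorem toHom_mul {X : GrOp} (f g : X ⟶ (⟨1⟩ : GrOp)) :
    toHom (f * g) (FreeGroup.of 0) = toHom f (FreeGroup.of 0) * toHom g (FreeGroup.of 0) := by
  -- The multiplication obtained from the representation is the product of the two projections in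
  -- the free group of `1 + 1`, that is the word `x_1 x_2`.
  have h : toHom μ[(⟨1⟩ : GrOp)] (FreeGroup.of 0) =
      toHom (fst (⟨1⟩ : GrOp) ⟨1⟩) (FreeGroup.of 0) *
        toHom (snd (⟨1⟩ : GrOp) ⟨1⟩) (FreeGroup.of 0) :=
    toHom_tuple_of (X := (⟨1⟩ : GrOp) ⊗ ⟨1⟩) (Y := ⟨1⟩) _ _
  rw [Hom.mul_def, toHom_comp, MonoidHom.comp_apply, h, map_mul, ← MonoidHom.comp_apply,
    ← MonoidHom.comp_apply, ← toHom_comp, ← toHom_comp, lift_fst, lift_snd]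

/-- The correspondence between words and morphisms to `1`, as a group homomorphism. -/
def wordHom (X : GrOp) : X.free →* (X ⟶ (⟨1⟩ : GrOp)) :=
  MonoidHom.mk' word fun a b => hom_one_ext <| by
    rw [toHom_mul, toHom_word, toHom_word, toHom_word]

theorem wordHom_toHom {X Y : GrOp} (f : X ⟶ Y) (i : Fin Y.rank) :
    wordHom X (toHom f (FreeGroup.of i)) = f ≫ wordHom Y (FreeGroup.of i) :=
  hom_one_ext <| (toHom_word _).trans (congrArg (toHom f) (toHom_word (FreeGroup.of i)).symm)

theorem wordHom_castSucc (n : ℕ) (i : Fin n) :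
    wordHom ⟨n + 1⟩ (FreeGroup.of i.castSucc) =
      fst (⟨n⟩ : GrOp) ⟨1⟩ ≫ wordHom ⟨n⟩ (FreeGroup.of i) :=
  (congrArg _ (toHom_fst (⟨n⟩ : GrOp) ⟨1⟩ i).symm).trans (wordHom_toHom _ _)

theorem wordHom_last (n : ℕ) :
    wordHom ⟨n + 1⟩ (FreeGroup.of (Fin.last n)) = snd (⟨n⟩ : GrOp) ⟨1⟩ :=
  hom_one_ext <| (toHom_word _).trans (toHom_snd (⟨n⟩ : GrOp) ⟨1⟩ 0).symm

end GrOp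

namespace GrpPower

open scoped MonObj Obj
open Functor.OplaxMonoidal

universe v w

variable {C : Type w} [Category.{v} C] [CartesianMonoidalCategory C] (F : GrOp ⥤ C) [F.Monoidal]
  {G : C} (e : F.obj ⟨1⟩ ⟶ G)

/-- A product preserving functor induces group homomorphisms on morphisms into the group object `1`,
and a homomorphism out of a free group is determined on generators. -/
theorem map_wordHom {X : GrOp} (w : X.free) :
    F.map (GrOp.wordHom X w) =
      FreeGroup.lift (fun i => F.map (GrOp.wordHom X (FreeGroup.of i))) w :=
  DFunLike.congr_fun (FreeGroup.ext_hom (F.homMonoidHom.comp (GrOp.wordHom X))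
    (FreeGroup.lift fun i => F.map (GrOp.wordHom X (FreeGroup.of i)))
    fun _ => FreeGroup.lift_apply_of.symm) w

theorem map_comp_tupleLift [GrpObj G] [IsMonHom e] {X Y : GrOp} (f : X ⟶ Y) :
    (F.map f ≫ tupleLift Y.rank fun i => F.map (GrOp.wordHom Y (FreeGroup.of i)) ≫ e) =
      (tupleLift X.rank fun i => F.map (GrOp.wordHom X (FreeGroup.of i)) ≫ e) ≫ powMap G f :=
  pow_ext Y.rank fun j => by
    rw [Category.assoc, tupleLift_proj, Category.assoc, powMap_proj, comp_freeGroup_lift,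
      ← Category.assoc, ← F.map_comp, ← GrOp.wordHom_toHom, map_wordHom, freeGroup_lift_comp]
    simp only [tupleLift_proj]

/-- The comparison of a product preserving functor on `gr^op` with the powers of a group object. -/
def toPow [GrpObj G] [IsMonHom e] : F ⟶ powFunctor G where
  app X := tupleLift X.rank fun i => F.map (GrOp.wordHom X (FreeGroup.of i)) ≫ e
  naturality _ _ f := map_comp_tupleLift F e f

/-- The comparison map factors through `F(n + 1) → F(n) ⊗ F(1)`, so its invertibility follows by
induction on `n`. -/
theorem tupleLift_map_wordHom_succ (n : ℕ) :
    (tupleLift (n + 1) fun i => F.map (GrOp.wordHom ⟨n + 1⟩ (FreeGroup.of i)) ≫ e) =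
      δ F ⟨n⟩ ⟨1⟩ ≫
        ((tupleLift n fun i => F.map (GrOp.wordHom ⟨n⟩ (FreeGroup.of i)) ≫ e) ⊗ₘ e) := by
  refine succ_ext ?_ ?_
  · refine (snoc_front _ _).trans (Eq.symm ((Category.assoc _ _ _).trans ?_))
    refine (_ ≫= tensorHom_fst _ _).trans ((Category.assoc _ _ _).symm.trans ?_)
    refine (δ_fst F _ _ =≫ _).trans (pow_ext n fun i => ?_)
    rw [tupleLift_proj, Category.assoc, tupleLift_proj, ← Category.assoc, ← F.map_comp]
    exact congrArg (F.map · ≫ e) (GrOp.wordHom_castSucc n i).symm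
  · refine (snoc_last _ _).trans (Eq.symm ((Category.assoc _ _ _).trans ?_))
    refine (_ ≫= tensorHom_snd _ _).trans ((Category.assoc _ _ _).symm.trans ?_)
    refine (δ_snd F _ _ =≫ _).trans ?_
    exact congrArg (F.map · ≫ e) (GrOp.wordHom_last n).symm

theorem isIso_tupleLift_map_wordHom [IsIso e] (n : ℕ) :
    IsIso (tupleLift n fun i => F.map (GrOp.wordHom ⟨n⟩ (FreeGroup.of i)) ≫ e) := by
  induction n with
  | zero =>
    have h : (tupleLift 0 fun i => F.map (GrOp.wordHom ⟨0⟩ (FreeGroup.of i)) ≫ e) =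
        Functor.OplaxMonoidal.η F := toUnit_unique _ _
    rw [h]
    exact inferInstanceAs (IsIso (Functor.OplaxMonoidal.η F))
  | succ n ih =>
    rw [tupleLift_map_wordHom_succ]
    exact IsIso.comp_isIso' (inferInstanceAs (IsIso (δ F ⟨n⟩ ⟨1⟩)))
      (MonoidalCategory.tensor_isIso _ e)

instance [GrpObj G] [IsMonHom e] [IsIso e] : IsIso (toPow F e) :=
  have (X : GrOp) : IsIso ((toPow F e).app X) := isIso_tupleLift_map_wordHom F e X.rank
  NatIso.isIso_of_isIso_app _

end GrpPower

/-! ### Group objects in cocommutative coalgebras are Hopf algebras -/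

namespace CocommCoalg

open scoped MonObj

variable {k : Type u} [CommRing k]

theorem isIso_of_isIso_toMod {C D : CocommCoalg k} (f : C ⟶ D) [IsIso ((toMod k).map f)] :
    IsIso f :=
  have h : Function.Bijective f.toCoalgHom :=
    (ConcreteCategory.bijective_of_isIso ((toMod k).map f) :)
  (isoMk (CoalgEquiv.ofBijective h)).isIso_hom

variable (G : CocommCoalg k) [GrpObj G]

/-- The Hopf algebra underlying a group object in cocommutative coalgebras. -/
def HopfCarrier (G : CocommCoalg k) : Type u := G.carrier

namespace HopfCarrier

section ring

/-- The additive group underlying `HopfCarrier G`. -/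
@[reducible]
def addCommGroupCarrier : AddCommGroup (HopfCarrier G) := G.addCommGroup

attribute [local instance] addCommGroupCarrier

/-- The module underlying `HopfCarrier G`. -/
@[reducible]
def moduleCarrier : Module k (HopfCarrier G) := G.module

attribute [local instance] moduleCarrier

/-- The multiplication of a group object, as a linear map. -/
noncomputable def mulMap : HopfCarrier G ⊗[k] HopfCarrier G →ₗ[k] HopfCarrier G :=
  μ[G].toCoalgHom.toLinearMap

/-- The unit of a group object, as a linear map. -/
noncomputable def oneMap : k →ₗ[k] HopfCarrier G := η[G].toCoalgHom.toLinearMap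

theorem mulMap_assoc (x y z : HopfCarrier G) :
    mulMap G (mulMap G (x ⊗ₜ[k] y) ⊗ₜ[k] z) = mulMap G (x ⊗ₜ[k] mulMap G (y ⊗ₜ[k] z)) :=
  DFunLike.congr_fun (congrArg (fun f => f.toCoalgHom.toLinearMap) (MonObj.mul_assoc G))
    ((x ⊗ₜ[k] y) ⊗ₜ[k] z)

theorem mulMap_oneMap_left (c : k) (x : HopfCarrier G) : mulMap G (oneMap G c ⊗ₜ[k] x) = c • x :=
  DFunLike.congr_fun (congrArg (fun f => f.toCoalgHom.toLinearMap) (MonObj.one_mul G)) (c ⊗ₜ[k] x)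

theorem mulMap_oneMap_right (c : k) (x : HopfCarrier G) : mulMap G (x ⊗ₜ[k] oneMap G c) = c • x :=
  DFunLike.congr_fun (congrArg (fun f => f.toCoalgHom.toLinearMap) (MonObj.mul_one G)) (x ⊗ₜ[k] c)

noncomputable instance : Ring (HopfCarrier G) where
  __ := addCommGroupCarrier G
  mul x y := mulMap G (x ⊗ₜ[k] y)
  one := oneMap G 1
  mul_assoc := mulMap_assoc G
  one_mul x := (mulMap_oneMap_left G 1 x).trans (one_smul k x)
  mul_one x := (mulMap_oneMap_right G 1 x).trans (one_smul k x)
  left_distrib x y z := (congrArg (mulMap G) (TensorProduct.tmul_add x y z)).trans (map_add _ _ _)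
  right_distrib x y z := (congrArg (mulMap G) (TensorProduct.add_tmul x y z)).trans (map_add _ _ _)
  zero_mul x := (congrArg (mulMap G) (TensorProduct.zero_tmul _ x)).trans (map_zero _)
  mul_zero x := (congrArg (mulMap G) (TensorProduct.tmul_zero _ x)).trans (map_zero _)

theorem mul_eq (x y : HopfCarrier G) : x * y = mulMap G (x ⊗ₜ[k] y) := rfl

noncomputable instance : Algebra k (HopfCarrier G) :=
  Algebra.ofModule
    (fun c x y => by
      rw [mul_eq, mul_eq, ← TensorProduct.smul_tmul', map_smul])
    (fun c x y => by
      rw [mul_eq, mul_eq, TensorProduct.tmul_smul, map_smul])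

end ring

noncomputable instance : Coalgebra k (HopfCarrier G) := G.coalgebra

instance : Coalgebra.IsCocomm k (HopfCarrier G) := G.isCocomm

theorem mul'_eq : LinearMap.mul' k (HopfCarrier G) = μ[G].toCoalgHom.toLinearMap :=
  TensorProduct.ext' fun _ _ => rfl

theorem linearMap_eq : η[G].toCoalgHom.toLinearMap = Algebra.linearMap k (HopfCarrier G) :=
  LinearMap.ext_ring (map_one (algebraMap k (HopfCarrier G))).symm

/-- This is the condition that the multiplication `G ⊗ G → G` is a coalgebra homomorphism, evaluated
on `a ⊗ b`. -/
theorem comul_mul (a b : HopfCarrier G) : Coalgebra.comul (R := k) (a * b) =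
    Coalgebra.comul (R := k) a * Coalgebra.comul (R := k) b := by
  have h : TensorProduct.map (LinearMap.mul' k (HopfCarrier G)) (LinearMap.mul' k (HopfCarrier G))
      (Coalgebra.comul (R := k) (a ⊗ₜ[k] b)) = Coalgebra.comul (R := k) (a * b) := by
    rw [mul'_eq]
    exact DFunLike.congr_fun μ[G].toCoalgHom.map_comp_comul (a ⊗ₜ[k] b)
  rw [← h, TensorProduct.comul_tmul]
  induction Coalgebra.comul (R := k) a using TensorProduct.induction_on with
  | zero => simp
  | add x y hx hy => simp only [TensorProduct.add_tmul, map_add, add_mul, hx, hy]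
  | tmul x x' =>
    induction Coalgebra.comul (R := k) b using TensorProduct.induction_on with
    | zero => simp
    | add y z hy hz => simp only [TensorProduct.tmul_add, map_add, mul_add, hy, hz]
    | tmul y y' => simp

noncomputable instance : Bialgebra k (HopfCarrier G) :=
  .mk' k (HopfCarrier G)
    (DFunLike.congr_fun η[G].toCoalgHom.counit_comp (1 : k))
    (fun {a b} => (DFunLike.congr_fun μ[G].toCoalgHom.counit_comp (a ⊗ₜ[k] b)).trans (mul_comm _ _))
    (DFunLike.congr_fun η[G].toCoalgHom.map_comp_comul (1 : k)).symm
    (comul_mul G _ _)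

noncomputable instance : HopfAlgebra k (HopfCarrier G) where
  antipode := ι[G].toCoalgHom.toLinearMap
  mul_antipode_rTensor_comul := by
    rw [mul'_eq, ← linearMap_eq]
    exact congrArg (fun f => f.toCoalgHom.toLinearMap) (GrpObj.left_inv G)
  mul_antipode_lTensor_comul := by
    rw [mul'_eq, ← linearMap_eq]
    exact congrArg (fun f => f.toCoalgHom.toLinearMap) (GrpObj.right_inv G)

end HopfCarrier

end CocommCoalg

namespace CocommCoalg

open scoped MonObj

variable {k : Type u} [CommRing k] (G : CocommCoalg k) [GrpObj G]

/-- The cocommutative Hopf algebra underlying a group object in cocommutative coalgebras. -/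
noncomputable def toCocommHopf : CocommHopf k where
  obj := HopfAlgCat.of k (HopfCarrier G)
  property := HopfCarrier.instIsCocomm G

/-- A group object is the one underlying its Hopf algebra. -/
noncomputable def toGrp : G ⟶ (toCocommHopf G).grp :=
  ⟨CoalgHom.id k G.carrier⟩

instance : IsIso (toGrp G) :=
  have : IsIso ((toMod k).map (toGrp G)) := inferInstanceAs (IsIso (𝟙 (ModuleCat.of k G.carrier)))
  isIso_of_isIso_toMod _

instance : IsMonHom (toGrp G) where
  one_hom := (toMod k).map_injective (ModuleCat.hom_ext (HopfCarrier.linearMap_eq G))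
  mul_hom := (toMod k).map_injective (ModuleCat.hom_ext (TensorProduct.ext' fun _ _ => rfl))

end CocommCoalg

/-! ### Lifting symmetric monoidal functors to cocommutative coalgebras -/

namespace GrModule

open Functor.OplaxMonoidal Functor.LaxMonoidal

variable {k : Type u} [CommRing k] (F : GrOp ⥤ ModuleCat.{u} k) [F.Braided]

/-- The comonoid structure on the values of a monoidal functor on `gr^op`. -/
noncomputable abbrev comonObj (X : GrOp) : ComonObj (F.obj X) :=
  letI : ComonObj X := ((cartesianComon GrOp).obj X).comon
  Functor.obj.instComonObj X F

/-- The coalgebra structure on the values of a monoidal functor on `gr^op`. -/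
@[reducible]
noncomputable def coalgebra (X : GrOp) : Coalgebra k (F.obj X) :=
  letI := comonObj F X
  { comul := (F.map (lift (𝟙 X) (𝟙 X)) ≫ δ F X X).hom
    counit := (F.map (toUnit X) ≫ Functor.OplaxMonoidal.η F).hom
    coassoc := ModuleCat.hom_ext_iff.mp (ComonObj.comul_assoc (F.obj X)).symm
    rTensor_counit_comp_comul := ModuleCat.hom_ext_iff.mp (ComonObj.counit_comul (F.obj X))
    lTensor_counit_comp_comul := ModuleCat.hom_ext_iff.mp (ComonObj.comul_counit (F.obj X)) }

/-- The diagonal of `X` is invariant under the exchange of factors; symmetry of `F` transfers this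
to cocommutativity of `F(X)`. -/
theorem diag_braiding (X : GrOp) :
    (F.map (lift (𝟙 X) (𝟙 X)) ≫ δ F X X) ≫ (β_ (F.obj X) (F.obj X)).hom =
      F.map (lift (𝟙 X) (𝟙 X)) ≫ δ F X X := by
  have h : δ F X X ≫ (β_ (F.obj X) (F.obj X)).hom = F.map (β_ X X).hom ≫ δ F X X := by
    simp [Functor.map_braiding]
  rw [Category.assoc, h, ← F.map_comp_assoc, lift_braiding_hom]

/-- The value of a symmetric monoidal functor on `gr^op`, as a cocommutative coalgebra. -/
noncomputable def coalgObj (X : GrOp) : CocommCoalg k :=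
  letI := coalgebra F X
  { carrier := F.obj X
    isCocomm := ⟨ModuleCat.hom_ext_iff.mp (diag_braiding F X)⟩ }

theorem map_diag {X Y : GrOp} (f : X ⟶ Y) :
    (F.map (lift (𝟙 X) (𝟙 X)) ≫ δ F X X) ≫ (F.map f ⊗ₘ F.map f) =
      F.map f ≫ F.map (lift (𝟙 Y) (𝟙 Y)) ≫ δ F Y Y := by
  rw [Category.assoc, δ_natural, ← F.map_comp_assoc, ← F.map_comp_assoc]
  simp

theorem map_counit {X Y : GrOp} (f : X ⟶ Y) :
    F.map f ≫ F.map (toUnit Y) ≫ Functor.OplaxMonoidal.η F =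
      F.map (toUnit X) ≫ Functor.OplaxMonoidal.η F := by
  rw [← F.map_comp_assoc, comp_toUnit]

/-- The lift of a symmetric monoidal functor on `gr^op` to cocommutative coalgebras. -/
noncomputable def toCoalg : GrOp ⥤ CocommCoalg k where
  obj X := coalgObj F X
  map {X Y} f := ⟨letI := coalgebra F X; letI := coalgebra F Y;
    { (F.map f).hom with
      counit_comp := ModuleCat.hom_ext_iff.mp (map_counit F f)
      map_comp_comul := ModuleCat.hom_ext_iff.mp (map_diag F f) }⟩
  map_id X := (CocommCoalg.toMod k).map_injective (F.map_id X)
  map_comp f g := (CocommCoalg.toMod k).map_injective (F.map_comp f g)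

/-- The comparison is the coproduct followed by `F(fst) ⊗ F(snd)`. Naturality of `δ` turns it into
`δ` composed with `F` of the pairing of the two projections, which is the identity. Hence the lift
preserves binary products because `F` is strong. -/
theorem toMod_prodComparison (X Y : GrOp) :
    (CocommCoalg.toMod k).map (CartesianMonoidalCategory.prodComparison (toCoalg F) X Y) =
      δ F X Y := by
  have h : (F.map (lift (𝟙 (X ⊗ Y)) (𝟙 (X ⊗ Y))) ≫ δ F (X ⊗ Y) (X ⊗ Y)) ≫
      (F.map (fst X Y) ⊗ₘ F.map (snd X Y)) = δ F X Y := by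
    rw [Category.assoc, δ_natural, ← F.map_comp_assoc]
    simp
  exact h

theorem toMod_terminalComparison :
    (CocommCoalg.toMod k).map (CartesianMonoidalCategory.terminalComparison (toCoalg F)) =
      Functor.OplaxMonoidal.η F := by
  have h : F.map (toUnit (𝟙_ GrOp)) ≫ Functor.OplaxMonoidal.η F = Functor.OplaxMonoidal.η F := by
    rw [toUnit_unique (toUnit (𝟙_ GrOp)) (𝟙 _), F.map_id, Category.id_comp]
  exact h

noncomputable instance : (toCoalg F).Monoidal :=
  letI := Functor.OplaxMonoidal.ofChosenFiniteProducts (toCoalg F)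
  have (X Y : GrOp) : IsIso (δ (toCoalg F) X Y) :=
    have : IsIso ((CocommCoalg.toMod k).map
        (CartesianMonoidalCategory.prodComparison (toCoalg F) X Y)) := by
      rw [toMod_prodComparison]
      exact inferInstanceAs (IsIso (δ F X Y))
    CocommCoalg.isIso_of_isIso_toMod _
  have : IsIso (Functor.OplaxMonoidal.η (toCoalg F)) :=
    have : IsIso ((CocommCoalg.toMod k).map
        (CartesianMonoidalCategory.terminalComparison (toCoalg F))) := by
      rw [toMod_terminalComparison]
      exact inferInstanceAs (IsIso (Functor.OplaxMonoidal.η F))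
    CocommCoalg.isIso_of_isIso_toMod _
  .ofOplaxMonoidal (toCoalg F)

/-- `F` is the module functor underlying `toCoalg F`. -/
noncomputable def isoToCoalg : F ≅ toCoalg F ⋙ CocommCoalg.toMod k :=
  NatIso.ofComponents (fun X => Iso.refl (F.obj X))
    fun _ => (Category.comp_id _).trans (Category.id_comp _).symm

/-- Both sides are inverse to `δ`. This makes the identification of `F` with its lift monoidal, so
that the final isomorphism lives among exponential modules. -/
theorem toMod_mu (X Y : GrOp) : (CocommCoalg.toMod k).map (μ (toCoalg F) X Y) = μ F X Y := by
  have h : (CocommCoalg.toMod k).map (μ (toCoalg F) X Y) ≫ δ F X Y = 𝟙 _ := by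
    refine (_ ≫= (toMod_prodComparison F X Y).symm).trans ?_
    refine ((CocommCoalg.toMod k).map_comp _ _).symm.trans ?_
    exact (congrArg _ (Functor.Monoidal.μ_δ (toCoalg F) X Y)).trans
      ((CocommCoalg.toMod k).map_id _)
  exact (cancel_mono (δ F X Y)).mp (h.trans (Functor.Monoidal.μ_δ F X Y).symm)

theorem toMod_epsilon : (CocommCoalg.toMod k).map (ε (toCoalg F)) = ε F := by
  have h : (CocommCoalg.toMod k).map (ε (toCoalg F)) ≫ Functor.OplaxMonoidal.η F = 𝟙 _ := by
    refine (_ ≫= (toMod_terminalComparison F).symm).trans ?_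
    refine ((CocommCoalg.toMod k).map_comp _ _).symm.trans ?_
    exact (congrArg _ (Functor.Monoidal.ε_η (toCoalg F))).trans ((CocommCoalg.toMod k).map_id _)
  exact (cancel_mono (Functor.OplaxMonoidal.η F)).mp (h.trans (Functor.Monoidal.ε_η F).symm)

instance : NatTrans.IsMonoidal (isoToCoalg F).hom where
  unit := (Category.comp_id _).trans ((toMod_epsilon F).symm.trans (Category.id_comp _).symm)
  tensor X Y := by
    have h : μ (toCoalg F ⋙ CocommCoalg.toMod k) X Y = μ F X Y :=
      (Category.id_comp _).trans (toMod_mu F X Y)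
    refine (Category.comp_id _).trans (h.symm.trans (Eq.symm ?_))
    exact ((id_tensorHom_id _ _) =≫ _).trans (Category.id_comp _)

open scoped Obj

/-- The Hopf algebra `F(1)`. -/
noncomputable def hopf : CocommHopf k := CocommCoalg.toCocommHopf ((toCoalg F).obj ⟨1⟩)

/-- A symmetric monoidal functor is determined by the Hopf algebra `F(1)`. -/
noncomputable def isoTensorPowers : F ≅ (hopf F).tensorPowers :=
  isoToCoalg F ≪≫ Functor.isoWhiskerRight
    (asIso (GrpPower.toPow (toCoalg F) (CocommCoalg.toGrp ((toCoalg F).obj ⟨1⟩)))) _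

instance : NatTrans.IsMonoidal (isoTensorPowers F).hom :=
  have : NatTrans.IsMonoidal (Functor.whiskerRight (GrpPower.toPow (toCoalg F)
      (CocommCoalg.toGrp ((toCoalg F).obj ⟨1⟩))) (CocommCoalg.toMod k)) :=
    NatTrans.IsMonoidal.whiskerRight _
  NatTrans.IsMonoidal.comp (isoToCoalg F).hom (Functor.whiskerRight (GrpPower.toPow (toCoalg F)
    (CocommCoalg.toGrp ((toCoalg F).obj ⟨1⟩))) (CocommCoalg.toMod k))

end GrModule

/-! ### Essential surjectivity and the theorem -/

namespace CocommHopf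

variable {k : Type u} [CommRing k]

theorem exists_iso_of_braided (F : GrOp ⥤ ModuleCat.{u} k) [F.Braided] :
    ∃ H : CocommHopf k, Nonempty (LaxBraidedFunctor.of H.tensorPowers ≅ LaxBraidedFunctor.of F) :=
  have h : NatTrans.IsMonoidal (GrModule.isoTensorPowers F).hom := inferInstance
  have : NatTrans.IsMonoidal (F₁ := (LaxBraidedFunctor.of F).toFunctor)
    (F₂ := (LaxBraidedFunctor.of (GrModule.hopf F).tensorPowers).toFunctor)
    (GrModule.isoTensorPowers F).hom := h
  ⟨GrModule.hopf F, ⟨(LaxBraidedFunctor.isoMk (F := LaxBraidedFunctor.of F)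
    (G := LaxBraidedFunctor.of (GrModule.hopf F).tensorPowers)
    (GrModule.isoTensorPowers F)).symm⟩⟩

theorem exists_iso_alpha_obj (F : ExpMod k) :
    ∃ H : CocommHopf k, Nonempty ((alpha k).obj H ≅ F) := by
  have := F.property.1
  have := F.property.2
  -- Invertibility of the lax structure maps promotes `F` to a strong symmetric monoidal functor.
  let : F.obj.toFunctor.Braided :=
    { Functor.Monoidal.ofLaxMonoidal F.obj.toFunctor with
      braided := F.obj.laxBraided.braided }
  obtain ⟨H, ⟨e⟩⟩ := exists_iso_of_braided F.obj.toFunctor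
  exact ⟨H, ⟨ObjectProperty.isoMk _ e⟩⟩

theorem nonempty_iso_of_alpha_obj_iso {H : CocommHopf k} {F : ExpMod k} (e : (alpha k).obj H ≅ F) :
    Nonempty (F.obj.toFunctor ≅ H.tensorPowers) :=
  ⟨{ hom := e.inv.hom.hom.hom
     inv := e.hom.hom.hom.hom
     hom_inv_id := congrArg (fun f => f.hom.hom.hom) e.inv_hom_id
     inv_hom_id := congrArg (fun f => f.hom.hom.hom) e.hom_inv_id }⟩

end CocommHopf

theorem theorem202312081733 (k : Type u) [CommRing k] :
    ∃ h : ∀ H : PrimCocommHopf k,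
        isPrimitiveExp k (((isPrimitiveHopf k).ι ⋙ CocommHopf.alpha k).obj H),
      ((isPrimitiveExp k).lift ((isPrimitiveHopf k).ι ⋙ CocommHopf.alpha k) h).Full ∧
      ((isPrimitiveExp k).lift ((isPrimitiveHopf k).ι ⋙ CocommHopf.alpha k) h).Faithful ∧
      (IsField k →
        ((isPrimitiveExp k).lift ((isPrimitiveHopf k).ι ⋙ CocommHopf.alpha k) h).IsEquivalence) := by
  have h (H : PrimCocommHopf k) :
      isPrimitiveExp k (((isPrimitiveHopf k).ι ⋙ CocommHopf.alpha k).obj H) :=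
    CocommHopf.isPrimitive_tensorPowers H.property
  have hfull : ((isPrimitiveExp k).lift
    ((isPrimitiveHopf k).ι ⋙ CocommHopf.alpha k) h).Full := inferInstance
  have hfaithful : ((isPrimitiveExp k).lift
    ((isPrimitiveHopf k).ι ⋙ CocommHopf.alpha k) h).Faithful := inferInstance
  refine ⟨h, hfull, hfaithful, fun hk => ⟨hfaithful, hfull, ⟨fun F => ?_⟩⟩⟩
  obtain ⟨H, ⟨e⟩⟩ := CocommHopf.exists_iso_alpha_obj F.obj
  obtain ⟨e'⟩ := CocommHopf.nonempty_iso_of_alpha_obj_iso e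
  -- The only use of the field hypothesis: the Hopf algebra found over any ring is primitive because
  -- the module it represents is.
  have hH : isPrimitiveHopf k H := CocommHopf.isPrimitive_of_isPrimitive_tensorPowers hk
    (GrModule.IsPrimitive.of_iso e' F.property)
  exact ⟨⟨H, hH⟩, ⟨ObjectProperty.isoMk _ e⟩⟩
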